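/- Let $N\ge 1$ and $d\ge 0$. For Lebesgue-almost every dataset $X=(x_1,\dots,x_N)\in(\mathbb{R}^d)^N$ (labels absorbed into the points) the following holds. Suppose that $X$ is strictly linearly separable, i.e. $w_*^\top x_n>0$ for all $n$ and some $w_*$. Let $\gamma=\max_{\|w\|=1}\min_n w^\top x_n$ be its margin and $\sigma_{\max}$ the largest singular value of the matrix with columns $x_n$. Then there is a unique max-margin separator $\hat w=\mathrm{argmin}\{\|w\|^2: w^\top x_n\ge 1\ \forall n\}$; put $\mathcal S=\{n:\hat w^\top x_n=1\}$. There are unique dual variables $\alpha_n\ge 0$, with $\alpha_n=0$ for $n\notin\mathcal S$, such that $\hat w=\sum_{n\in\mathcal S}\alpha_n x_n$. Assume moreover that the support vectors span the data: $\mathrm{rank}\{x_n\}_{n\in\mathcal S}=\mathrm{rank}\{x_n\}_{n\le N}$. Then for every starting point $w(0)\in\mathbb{R}^d$ there is a unique $\tilde w$, depending only on $X$ and $w(0)$, with $$\exp(-x_n^\top\tilde w)=\alpha_n\ \ (n\in\mathcal S),\qquad (I-P)(\tilde w-w(0))=0,$$ where $P$ is the orthogonal projection onto $\mathrm{span}\{x_n\}_{n\in\mathcal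 S}$, and it has the following properties. Let $\ell:\mathbb{R}\to\mathbb{R}$ be positive and differentiable, with $\ell'$ $\beta$-Lipschitz, $\ell'<0$, $\ell(u)\to0$ and $\ell'(u)\to0$ as $u\to\infty$, and $\limsup_{u\to-\infty}\ell'(u)\ne0$. Suppose that $-\ell'$ has a tight exponential tail: for some $\mu_+,\mu_-,\bar u>0$, $(1-e^{-\mu_-u})e^{-u}\le-\ell'(u)\le(1+e^{-\mu_+u})e^{-u}$ for all $u>\bar u$. Let $B,K\ge1$ be integers with $BK=N$, let $\eta>0$, and let $$w(t+1)=w(t)-\frac{\eta}{B}\sum_{n\in\mathcal B(t)}\ell'(w(t)^\top x_n)\,x_n ,\qquad |\mathcal B(t)|=B,$$ where one of the following holds. Case 1 (with replacement): the minibatches $\mathcal B(t)$ are random and independent over $t$, each sample has the same probability to belong to $\mathcal B(t)$, and $\frac{\eta}{B}<\frac{2\gamma^2}{\beta\sigma_{\max}^4}$. Case 2 (without replacement): for every $u\ge0$ the minibatches $\mathcal B(Ku),\dots,\mathcal B(Ku+K-1)$ partition $\{1,\dots,N\}$ (and are otherwise arbitrary), and $\frac{\eta}{B}<\min\left[\frac{1}{2K\beta\sigma_{\max}^2},\frac{\gamma}{2\beta\sigma_{\max}^3(K+\gamma^{-1}\sigma_{\max})}\right]$.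 Then, almost surely in Case 1 and surely in Case 2, as $t\to\infty$, $$w(t)=\hat w\,\log\left(\frac{\eta}{B}\cdot\frac tK\right)+\tilde w+o(1),$$ with the above $\tilde w$, which does not depend on $K$, $\eta$ or $B$. Hence, if two such runs $w_1,w_2$ with the same $\ell$, $\beta$ and $w(0)$ have parameters $(\eta_i,B_i,K_i)$ with $\eta_1/B_1=\eta_2/B_2$, then $w_1(\lfloor K_1\tau\rfloor)-w_2(\lfloor K_2\tau\rfloor)\to0$ as the number of epochs $\tau\in\mathbb{R}$ tends to infinity (surely if both runs are in Case 2, almost surely otherwise, for runs on a common probability space). That is, changing the number of minibatches is asymptotically only a linear rescaling of time. -/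

import Mathlib

open Filter Topology MeasureTheory ProbabilityTheory
open scoped NNReal

noncomputable section

namespace MinibatchSGD

/-- A dataset of `N` points in `ℝ^d`, the labels being absorbed into the points. It carries the
Lebesgue measure of `(ℝ^d)^N`. -/
abbrev Dataset (N d : ℕ) : Type := Fin N → EuclideanSpace ℝ (Fin d)

variable {N d : ℕ}

/-- Strict linear separability. -/
def LinearlySeparable (X : Dataset N d) : Prop :=
  ∃ w : EuclideanSpace ℝ (Fin d), ∀ n, 0 < inner ℝ w (X n)

/-- The maximal `L₂` margin `γ = max_{‖w‖ = 1} min_n wᵀ x_n`. -/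
def margin (X : Dataset N d) : ℝ :=
  sSup {m : ℝ | ∃ w : EuclideanSpace ℝ (Fin d), ‖w‖ = 1 ∧ m = ⨅ n, inner ℝ w (X n)}

/-- The data matrix, whose columns are the samples, as a map `v ↦ ∑ n, v_n x_n` between Euclidean
spaces. -/
def dataMap (X : Dataset N d) : EuclideanSpace ℝ (Fin N) →L[ℝ] EuclideanSpace ℝ (Fin d) :=
  ∑ n, (EuclideanSpace.proj n : EuclideanSpace ℝ (Fin N) →L[ℝ] ℝ).smulRight (X n)

/-- The maximal singular value of the data matrix, i.e. its `L₂` operator norm. -/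
def sigmaMax (X : Dataset N d) : ℝ := ‖dataMap X‖

/-- Positive, differentiable, `β`-smooth loss, strictly decreasing to zero, whose derivative does
not vanish in the upper limit at `-∞`. The upper limit is taken in the extended reals, because the
derivative may tend to `-∞`. -/
structure IsSmoothMonotoneLoss (ℓ : ℝ → ℝ) (β : ℝ≥0) : Prop where
  differentiable : Differentiable ℝ ℓ
  smooth : LipschitzWith β (deriv ℓ)
  pos : ∀ u, 0 < ℓ u
  deriv_neg : ∀ u, deriv ℓ u < 0
  tendsto_zero : Tendsto ℓ atTop (𝓝 0)
  deriv_tendsto_zero : Tendsto (deriv ℓ) atTop (𝓝 0)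
  limsup_ne : limsup (fun u => ((deriv ℓ u : ℝ) : EReal)) atBot ≠ 0

/-- Tight exponential tail. -/
def HasTightExpTail (f : ℝ → ℝ) : Prop :=
  ∃ μp μm ubar : ℝ, 0 < μp ∧ 0 < μm ∧ 0 < ubar ∧ ∀ u, ubar < u →
    (1 - Real.exp (-μm * u)) * Real.exp (-u) ≤ f u ∧
    f u ≤ (1 + Real.exp (-μp * u)) * Real.exp (-u)

/-- The iterates of minibatch SGD,
`w(t+1) = w(t) - (η/B) ∑_{n ∈ 𝓑(t)} ℓ'(w(t)ᵀ x_n) x_n`, from the starting point `w0`. -/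
def sgd (X : Dataset N d) (ℓ : ℝ → ℝ) (η : ℝ) (B : ℕ) (batch : ℕ → Finset (Fin N))
    (w0 : EuclideanSpace ℝ (Fin d)) : ℕ → EuclideanSpace ℝ (Fin d)
  | 0 => w0
  | t + 1 => sgd X ℓ η B batch w0 t -
      (η / B) • ∑ n ∈ batch t, deriv ℓ (inner ℝ (sgd X ℓ η B batch w0 t) (X n)) • X n

/-- Random sampling with replacement: independently at each iteration a random set of `B` distinct
indices is drawn, and every sample has the same probability to be selected. -/
structure SamplingWithReplacement {Ω : Type*} [MeasurableSpace Ω] (μ : Measure Ω) (B : ℕ)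
    (batch : ℕ → Ω → Finset (Fin N)) : Prop where
  measurable : ∀ t, Measurable[_, ⊤] (batch t)
  indep : iIndepFun (m := fun _ => ⊤) batch μ
  card_eq : ∀ t ω, (batch t ω).card = B
  uniform : ∀ t n m, μ {ω | n ∈ batch t ω} = μ {ω | m ∈ batch t ω}

/-- Sampling without replacement: at each epoch, the `K` minibatches of size `B` cover (hence,
when `B * K = N`, partition) the data. -/
structure SamplingWithoutReplacement (B K : ℕ) (batch : ℕ → Finset (Fin N)) : Prop where
  card_eq : ∀ t, (batch t).card = B
  cover : ∀ u : ℕ, ∀ n : Fin N, ∃ k < K, n ∈ batch (K * u + k)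

/-- Learning-rate condition for sampling with replacement. Note that `β σ_max²` is the smoothness
constant of the empirical loss. -/
def StepSizeWith (X : Dataset N d) (β : ℝ≥0) (η : ℝ) (B : ℕ) : Prop :=
  η / B < 2 * margin X ^ 2 / ((β * sigmaMax X ^ 2) * sigmaMax X ^ 2)

/-- Learning-rate condition for sampling without replacement. -/
def StepSizeWithout (X : Dataset N d) (β : ℝ≥0) (η : ℝ) (B K : ℕ) : Prop :=
  η / B < min (1 / (2 * K * β * sigmaMax X ^ 2))
    (margin X / (2 * β * sigmaMax X ^ 3 * (K + (margin X)⁻¹ * sigmaMax X)))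

/-- Case 1: SGD with random sampling with replacement and an admissible learning rate. -/
def CaseWith {Ω : Type*} [MeasurableSpace Ω] (μ : Measure Ω) (X : Dataset N d) (β : ℝ≥0) (η : ℝ)
    (B K : ℕ) (batch : ℕ → Ω → Finset (Fin N)) : Prop :=
  0 < η ∧ B * K = N ∧ StepSizeWith X β η B ∧ SamplingWithReplacement μ B batch

/-- Case 2: SGD with sampling without replacement and an admissible learning rate. -/
def CaseWithout (X : Dataset N d) (β : ℝ≥0) (η : ℝ) (B K : ℕ)
    (batch : ℕ → Finset (Fin N)) : Prop :=
  0 < η ∧ B * K = N ∧ StepSizeWithout X β η B K ∧ SamplingWithoutReplacement B K batch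

/-- `what` solves `argmin ‖w‖²` subject to `wᵀ x_n ≥ 1` for all `n`. -/
def IsMaxMarginSeparator (X : Dataset N d) (what : EuclideanSpace ℝ (Fin d)) : Prop :=
  (∀ n, 1 ≤ inner ℝ what (X n)) ∧
    ∀ w : EuclideanSpace ℝ (Fin d), (∀ n, 1 ≤ inner ℝ w (X n)) → ‖what‖ ^ 2 ≤ ‖w‖ ^ 2

/-- The indices of the support vectors. -/
def supportIdx (X : Dataset N d) (what : EuclideanSpace ℝ (Fin d)) : Set (Fin N) :=
  {n | inner ℝ what (X n) = 1}

/-- The subspace spanned by the support vectors. -/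
def supportSpan (X : Dataset N d) (what : EuclideanSpace ℝ (Fin d)) :
    Submodule ℝ (EuclideanSpace ℝ (Fin d)) :=
  Submodule.span ℝ (X '' supportIdx X what)

/-- `α` are the SVM dual variables (multipliers) of `what`: nonnegative, supported on the support
vectors, with `what = ∑ α_n x_n`. -/
def IsSVMDual (X : Dataset N d) (what : EuclideanSpace ℝ (Fin d)) (α : Fin N → ℝ) : Prop :=
  (∀ n, 0 ≤ α n) ∧ (∀ n, n ∉ supportIdx X what → α n = 0) ∧ what = ∑ n, α n • X n

/-- The support vectors span the data: `rank X_S = rank X`. -/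
def SupportVectorsSpan (X : Dataset N d) (what : EuclideanSpace ℝ (Fin d)) : Prop :=
  Set.finrank ℝ (X '' supportIdx X what) = Set.finrank ℝ (Set.range X)

/-- The equations for `wtilde`: `exp (-x_nᵀ wtilde) = α_n` on the support vectors and
`(I - P) (wtilde - w0) = 0`, with `P` the orthogonal projection onto the span of the support
vectors. -/
def IsResidualLimit (X : Dataset N d) (what : EuclideanSpace ℝ (Fin d)) (α : Fin N → ℝ)
    (w0 wtilde : EuclideanSpace ℝ (Fin d)) : Prop :=
  (∀ n ∈ supportIdx X what, Real.exp (-inner ℝ (X n) wtilde) = α n) ∧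
    (wtilde - w0) - (supportSpan X what).starProjection (wtilde - w0) = 0

/-- `w(t) = what log((η/B) t/K) + wtilde + o(1)`. -/
def HasLogAsymptotics (w : ℕ → EuclideanSpace ℝ (Fin d)) (what wtilde : EuclideanSpace ℝ (Fin d))
    (η : ℝ) (B K : ℕ) : Prop :=
  Tendsto (fun t : ℕ => w t - (Real.log ((η / B) * (t / K)) • what + wtilde)) atTop (𝓝 0)

/-- Two runs with `K₁` and `K₂` minibatches per epoch agree asymptotically when time is measured in
epochs `τ`, i.e. they differ by the linear rescaling of time `t₁ / K₁ = t₂ / K₂` and by `o(1)`. -/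
def AgreePerEpoch (w₁ w₂ : ℕ → EuclideanSpace ℝ (Fin d)) (K₁ K₂ : ℕ) : Prop :=
  Tendsto (fun τ : ℝ => w₁ ⌊K₁ * τ⌋₊ - w₂ ⌊K₂ * τ⌋₊) atTop (𝓝 0)

end MinibatchSGD

end

/-! Let `r(t)` be the deviation of `w(t)` from the claimed asymptotics and `h = η / B`. As
`what = ∑ n, α_n x_n` with `α_n = exp (-x_nᵀ wtilde)` on the support vectors, the growth of the
logarithm cancels the gradient steps to leading order: up to summable terms, the increment of
`‖r‖²` is a positive multiple of `(1/t) ∑ n, α_n z_n (exp (-z_n) - 1)` with `z_n = r(t)ᵀ x_n`. No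
summand is positive, and for `‖r‖` bounded below the sum is bounded away from zero, because `r`
stays in the span of the support vectors. As `∑ 1/t` diverges, `r` tends to `0`.

This works for every trajectory whose coefficients are asymptotic to `exp (-w(t)ᵀ x_n)` and square
summable. Without replacement the epochs form such a trajectory, since each of them decreases the
loss by a multiple of the squared gradient. With replacement the same decrease holds in expectation,
so the sampling noise is a sum of martingales with summable variances and converges; adding to
`w(t)` the noise still to come gives a trajectory of full-batch steps, with a starting point that
moved only within the span.

For almost every dataset no sample lies on the margin hyperplane determined by others. By
Carathéodory's theorem the max-margin separator is a combination of linearly independent support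
vectors with positive coefficients; genericity excludes further support vectors, so that all dual
variables are positive and unique.
-/

namespace MinibatchSGD

section Drift

variable {a b s γ : ℕ → ℝ} {R : ℝ}

theorem eventually_sum_Ico_le (hs₀ : ∀ t, 0 ≤ s t) (hs : Summable s) (hR : 0 < R) :
    ∀ᶠ T in atTop, ∀ t, ∑ i ∈ Finset.Ico T t, s i ≤ R := by
  filter_upwards [(tendsto_sum_nat_add s).eventually_le_const hR] with T hT t
  rw [Finset.sum_Ico_eq_sum_range]
  simp only [add_comm T]
  exact (((summable_nat_add_iff T).2 hs).sum_le_tsum _ fun i _ => hs₀ _).trans hT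

theorem exists_lt_of_drift {c r : ℝ} {T : ℕ} (ha : ∀ t, 0 ≤ a t) (hγ₀ : ∀ t, 0 ≤ γ t)
    (hγ : ¬Summable γ) (hs : ∀ t, ∑ i ∈ Finset.Ico T t, s i ≤ R) (hc : 0 < c)
    (hstep : ∀ t ≥ T, r ≤ a t → a (t + 1) ≤ a t - c * γ t + s t) : ∃ t ≥ T, a t < r := by
  by_contra! hr
  have hbound : ∀ t ≥ T, a t + c * ∑ i ∈ Finset.Ico T t, γ i ≤ a T + ∑ i ∈ Finset.Ico T t, s i := by
    refine Nat.le_induction (by simp) fun t ht ih => ?_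
    rw [Finset.sum_Ico_succ_top ht, Finset.sum_Ico_succ_top ht]
    linarith [hstep t ht (hr t ht)]
  have hdiv : Tendsto (fun t => c * ∑ i ∈ Finset.Ico T t, γ i) atTop atTop := by
    refine Tendsto.const_mul_atTop hc ?_
    refine (tendsto_atTop_add_const_right _ (-∑ i ∈ Finset.range T, γ i)
      ((not_summable_iff_tendsto_nat_atTop_of_nonneg hγ₀).1 hγ)).congr' ?_
    filter_upwards [eventually_ge_atTop T] with t ht
    rw [Finset.sum_Ico_eq_sub _ ht, sub_eq_add_neg]
  obtain ⟨t, htT, ht⟩ :=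
    ((eventually_ge_atTop T).and (hdiv.eventually_gt_atTop (a T + R))).exists
  linarith [hbound t htT, hs t, ha t]

theorem le_add_sum_of_drift {c : ℝ} {T : ℕ} (hs₀ : ∀ t, 0 ≤ s t) (hT : a T ≤ c)
    (hstep : ∀ t ≥ T, a (t + 1) ≤ max (a t) c + s t) {t : ℕ} (ht : T ≤ t) :
    a t ≤ c + ∑ i ∈ Finset.Ico T t, s i := by
  induction t, ht using Nat.le_induction with
  | base => simpa using hT
  | succ t ht ih =>
    rw [Finset.sum_Ico_succ_top ht]
    have hmax : max (a t) c ≤ c + ∑ i ∈ Finset.Ico T t, s i :=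
      max_le ih (le_add_of_nonneg_right (Finset.sum_nonneg fun i _ => hs₀ i))
    linarith [hstep t ht]

theorem tendsto_zero_of_drift (ha : ∀ t, 0 ≤ a t) (hγ₀ : ∀ t, 0 ≤ γ t) (hγ₁ : ∀ t, γ t ≤ 1)
    (hγ : ¬Summable γ) (hs₀ : ∀ t, 0 ≤ s t) (hs : Summable s)
    (hstep : ∀ t, a (t + 1) ≤ a t + γ t * b t + s t)
    (hsmall : ∀ R > 0, ∀ᶠ t in atTop, b t ≤ R)
    (hneg : ∀ R > 0, ∃ c > 0, ∀ᶠ t in atTop, R ≤ a t → b t ≤ -c) :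
    Tendsto a atTop (𝓝 0) := by
  refine tendsto_order.2 ⟨fun ε hε => Eventually.of_forall fun t => hε.trans_le (ha t),
    fun ε hε => ?_⟩
  obtain ⟨R, hR, rfl⟩ : ∃ R > 0, 4 * R = ε := ⟨ε / 4, by positivity, by ring⟩
  obtain ⟨c, hc, hneg⟩ := hneg R hR
  obtain ⟨T₀, hT₀⟩ := eventually_atTop.1
    ((hneg.and (hsmall R hR)).and (eventually_sum_Ico_le hs₀ hs hR))
  obtain ⟨T, hT, haT⟩ : ∃ T ≥ T₀, a T < R := by
    refine exists_lt_of_drift ha hγ₀ hγ (hT₀ T₀ le_rfl).2 hc fun t ht hRt => ?_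
    have := mul_le_mul_of_nonneg_left ((hT₀ t ht).1.1 hRt) (hγ₀ t)
    linarith [hstep t]
  have hclimb : ∀ t ≥ T, a (t + 1) ≤ max (a t) (2 * R) + s t := by
    intro t ht
    obtain ⟨hneg, hsmall⟩ := (hT₀ t (hT.trans ht)).1
    rcases le_or_gt R (a t) with h | h
    · have : γ t * b t ≤ 0 :=
        mul_nonpos_of_nonneg_of_nonpos (hγ₀ t) ((hneg h).trans (neg_nonpos.2 hc.le))
      linarith [hstep t, le_max_left (a t) (2 * R)]
    · have : γ t * b t ≤ 1 * R :=
        (mul_le_mul_of_nonneg_left hsmall (hγ₀ t)).trans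
          (mul_le_mul_of_nonneg_right (hγ₁ t) hR.le)
      linarith [hstep t, le_max_right (a t) (2 * R)]
  filter_upwards [eventually_ge_atTop T] with t ht
  linarith [le_add_sum_of_drift hs₀ (by linarith) hclimb ht, (hT₀ T hT).2 t]

end Drift

section ExpDrift

theorem mul_exp_neg_le_one (z : ℝ) : z * Real.exp (-z) ≤ 1 := by
  rw [Real.exp_neg, ← div_eq_mul_inv, div_le_one (Real.exp_pos z)]
  linarith [Real.add_one_le_exp z]

theorem mul_exp_sub_one_nonneg (z : ℝ) : 0 ≤ z * (Real.exp z - 1) := by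
  rcases le_total 0 z with h | h
  · exact mul_nonneg h (sub_nonneg.2 (Real.one_le_exp h))
  · exact mul_nonneg_of_nonpos_of_nonpos h (sub_nonpos.2 (Real.exp_le_one_iff.2 h))

theorem mul_exp_sub_sub_one_le (L z : ℝ) :
    z * (Real.exp (L - z) - 1) ≤ L * (Real.exp L - 1) := by
  have hLz := mul_exp_sub_one_nonneg (L - z)
  rcases le_total 0 L with hL | hL <;> rcases le_total 0 z with hz | hz
  · have : Real.exp (L - z) ≤ Real.exp L := Real.exp_le_exp.2 (by linarith)
    nlinarith
  · have : 1 ≤ Real.exp (L - z) := Real.one_le_exp (by linarith)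
    nlinarith [mul_exp_sub_one_nonneg L]
  · have : Real.exp (L - z) ≤ 1 := Real.exp_le_one_iff.2 (by linarith)
    nlinarith [mul_exp_sub_one_nonneg L]
  · have : Real.exp L ≤ Real.exp (L - z) := Real.exp_le_exp.2 (by linarith)
    nlinarith

theorem mul_mul_exp_neg_sub_le {x y : ℝ} (hx : 0 < x) (hy : 0 < y) (z : ℝ) :
    z * (x * Real.exp (-z) - y) ≤ (x - y) * Real.log (x / y) := by
  have hexp : y * Real.exp (Real.log (x / y)) = x := by
    rw [Real.exp_log (by positivity), mul_div_cancel₀ _ hy.ne']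
  have h := mul_le_mul_of_nonneg_left (mul_exp_sub_sub_one_le (Real.log (x / y)) z) hy.le
  rw [sub_eq_add_neg (Real.log _), Real.exp_add] at h
  linear_combination h + z * Real.exp (-z) * hexp.symm + Real.log (x / y) * hexp

variable {T : Type*} {l : Filter T} {y κ : T → ℝ} {α : ℝ}

theorem eventually_exp_drift_le (hα : 0 ≤ α) (hy : Tendsto y l (𝓝 α)) (hy₀ : ∀ t, 0 ≤ y t)
    (hκ : Tendsto κ l (𝓝 1)) {R : ℝ} (hR : 0 < R) :
    ∀ᶠ t in l, ∀ z, z * (y t * Real.exp (-z) - κ t * α) ≤ R := by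
  rcases hα.eq_or_lt with rfl | hα
  · filter_upwards [hy.eventually_le_const hR] with t ht z
    nlinarith [mul_le_mul_of_nonneg_left (mul_exp_neg_le_one z) (hy₀ t)]
  · have hκα : Tendsto (fun t => κ t * α) l (𝓝 α) := by simpa using hκ.mul_const α
    have hbound : Tendsto (fun t => (y t - κ t * α) * Real.log (y t / (κ t * α))) l (𝓝 0) := by
      simpa [hα.ne'] using (hy.sub hκα).mul ((hy.div hκα hα.ne').log (by simp [hα.ne']))
    filter_upwards [hbound.eventually_le_const hR, hy.eventually_const_lt hα,
      hκα.eventually_const_lt hα] with t ht hyt hκt z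
    exact (mul_mul_exp_neg_sub_le hyt hκt z).trans ht

theorem eventually_exp_drift_le_neg (hα : 0 < α) (hy : Tendsto y l (𝓝 α))
    (hκ : Tendsto κ l (𝓝 1)) {ρ : ℝ} (hρ : 0 < ρ) :
    ∀ᶠ c in 𝓝[>] 0, ∀ᶠ t in l, ∀ z, ρ ≤ |z| → z * (y t * Real.exp (-z) - κ t * α) ≤ -c := by
  obtain ⟨δ, hδ, hδ₁⟩ : ∃ δ > 0, δ < α * (1 - Real.exp (-ρ)) :=
    exists_between (mul_pos hα (by simpa using hρ))
  have hδ₂ : δ < α * (Real.exp ρ - 1) := by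
    have : 2 ≤ Real.exp ρ + Real.exp (-ρ) := by
      linarith [Real.one_le_cosh ρ, Real.cosh_eq ρ]
    nlinarith
  have hlim : ∀ e, Tendsto (fun t => y t * e - κ t * α) l (𝓝 (α * e - 1 * α)) := fun e =>
    (hy.mul_const e).sub (hκ.mul_const α)
  filter_upwards [Ioo_mem_nhdsGT (mul_pos hρ hδ)] with c hc
  filter_upwards [(hlim (Real.exp (-ρ))).eventually_le_const (u := -δ) (by linarith),
    (hlim (Real.exp ρ)).eventually_const_le (u := δ) (by linarith),
    hy.eventually_const_le hα] with t hle hge hyt z hz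
  rcases le_abs.1 hz with hz | hz
  · have : y t * Real.exp (-z) ≤ y t * Real.exp (-ρ) := by gcongr
    nlinarith [hc.2]
  · have : y t * Real.exp ρ ≤ y t * Real.exp (-z) := by gcongr
    nlinarith [hc.2]

variable {ι : Type*} [Fintype ι] {Y : T → ι → ℝ} {A : ι → ℝ}

theorem eventually_sum_exp_drift_le (hA : ∀ n, 0 ≤ A n) (hY : ∀ n, Tendsto (Y · n) l (𝓝 (A n)))
    (hY₀ : ∀ t n, 0 ≤ Y t n) (hκ : Tendsto κ l (𝓝 1)) {R : ℝ} (hR : 0 < R) :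
    ∀ᶠ t in l, ∀ z : ι → ℝ, ∑ n, z n * (Y t n * Real.exp (-z n) - κ t * A n) ≤ R := by
  have hR' : 0 < R / (Fintype.card ι + 1) := by positivity
  filter_upwards [eventually_all.2 fun n =>
    eventually_exp_drift_le (hA n) (hY n) (hY₀ · n) hκ hR'] with t ht z
  calc ∑ n, z n * (Y t n * Real.exp (-z n) - κ t * A n)
    _ ≤ ∑ _n : ι, R / (Fintype.card ι + 1) := Finset.sum_le_sum fun n _ => ht n (z n)
    _ = Fintype.card ι / (Fintype.card ι + 1) * R := by simp; ring
    _ ≤ R := mul_le_of_le_one_left hR.le (div_le_one_of_le₀ (by linarith) (by positivity))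

theorem eventually_sum_exp_drift_le_neg (hA : ∀ n, 0 ≤ A n)
    (hY : ∀ n, Tendsto (Y · n) l (𝓝 (A n))) (hY₀ : ∀ t n, 0 ≤ Y t n) (hκ : Tendsto κ l (𝓝 1))
    {ρ : ℝ} (hρ : 0 < ρ) :
    ∃ c > 0, ∀ᶠ t in l, ∀ z : ι → ℝ, (∃ n, 0 < A n ∧ ρ ≤ |z n|) →
      ∑ n, z n * (Y t n * Real.exp (-z n) - κ t * A n) ≤ -c := by
  classical
  have hneg : ∀ n, ∀ᶠ c in 𝓝[>] (0 : ℝ), 0 < A n → ∀ᶠ t in l, ∀ z, ρ ≤ |z| →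
      z * (Y t n * Real.exp (-z) - κ t * A n) ≤ -c := fun n => by
    by_cases hn : 0 < A n
    · simpa only [hn, forall_const] using eventually_exp_drift_le_neg hn (hY n) hκ hρ
    · simp only [hn, false_imp_iff, eventually_true]
  obtain ⟨c, hc, hcpos⟩ := ((eventually_all.2 hneg).and self_mem_nhdsWithin).exists
  replace hcpos : 0 < c := hcpos
  have hR : 0 < c / (2 * (Fintype.card ι + 1)) := by positivity
  refine ⟨c / 2, by positivity, ?_⟩
  filter_upwards [eventually_all.2 fun n => eventually_imp_distrib_left.2 (hc n),
    eventually_all.2 fun n => eventually_exp_drift_le (hA n) (hY n) (hY₀ · n) hκ hR]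
    with t hneg hsmall z ⟨m, hm, hzm⟩
  have hrest : ∑ n ∈ Finset.univ.erase m, z n * (Y t n * Real.exp (-z n) - κ t * A n) ≤ c / 2 :=
    calc _ ≤ ∑ _n ∈ Finset.univ.erase m, c / (2 * (Fintype.card ι + 1)) :=
          Finset.sum_le_sum fun n _ => hsmall n (z n)
      _ ≤ ∑ _n : ι, c / (2 * (Fintype.card ι + 1)) :=
          Finset.sum_le_sum_of_subset_of_nonneg (Finset.erase_subset _ _) fun _ _ _ => hR.le
      _ = Fintype.card ι / (Fintype.card ι + 1) * (c / 2) := by simp; field_simp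
      _ ≤ c / 2 :=
          mul_le_of_le_one_left (by positivity) (div_le_one_of_le₀ (by linarith) (by positivity))
  rw [← Finset.add_sum_erase _ _ (Finset.mem_univ m)]
  linarith [hneg m hm (z m) hzm]

end ExpDrift

section RealSequences

theorem summable_of_descent {L g : ℕ → ℝ} {c : ℝ} (hc : 0 < c) (hL : ∀ t, 0 ≤ L t)
    (hg : ∀ t, 0 ≤ g t) (hdesc : ∀ t, L (t + 1) ≤ L t - c * g t) : Summable g := by
  have hsum : ∀ T, c * ∑ t ∈ Finset.range T, g t ≤ L 0 - L T := by
    intro T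
    induction T with
    | zero => simp
    | succ T ih => rw [Finset.sum_range_succ]; linarith [hdesc T]
  refine summable_of_sum_range_le (c := L 0 / c) hg fun T => ?_
  rw [le_div_iff₀' hc]
  linarith [hsum T, hL T]

theorem tendsto_zero_of_summable_sq {f : ℕ → ℝ} (hf : Summable fun t => f t ^ 2) :
    Tendsto f atTop (𝓝 0) := by
  rw [tendsto_zero_iff_abs_tendsto_zero]
  simpa [Real.sqrt_sq_eq_abs, Function.comp_def] using hf.tendsto_atTop_zero.sqrt

theorem tendsto_log_sub_log {ι : Type*} {l : Filter ι} {f g : ι → ℝ}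
    (h : Tendsto (fun i => f i / g i) l (𝓝 1)) :
    Tendsto (fun i => Real.log (f i) - Real.log (g i)) l (𝓝 0) := by
  refine Tendsto.congr' ?_ (by simpa using h.log one_ne_zero)
  filter_upwards [h.eventually_ne one_ne_zero] with i hi
  rw [div_ne_zero_iff] at hi
  exact Real.log_div hi.1 hi.2

theorem tendsto_log_mul_floor_sub {ι : Type*} {l : Filter ι} {u : ι → ℝ} {h : ℝ} (hh : h ≠ 0)
    (hu : Tendsto u l atTop) :
    Tendsto (fun i => Real.log (h * ⌊u i⌋₊) - Real.log (h * u i)) l (𝓝 0) := by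
  refine tendsto_log_sub_log ?_
  simpa only [mul_div_mul_left _ _ hh, Function.comp_def] using
    (tendsto_nat_floor_div_atTop (R := ℝ)).comp hu

theorem tendsto_log_mul_floor_div_sub {h K : ℝ} (hh : h ≠ 0) (hK : 0 < K) :
    Tendsto (fun τ : ℝ => Real.log (h * (⌊K * τ⌋₊ / K)) - Real.log (h * τ)) atTop (𝓝 0) := by
  refine (tendsto_log_mul_floor_sub (div_ne_zero hh hK.ne')
    (tendsto_id.const_mul_atTop hK)).congr fun τ => ?_
  congr 2 <;> simp only [id] <;> field_simp

theorem not_summable_one_div_succ : ¬Summable fun t : ℕ => 1 / ((t : ℝ) + 1) := by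
  simpa using (summable_nat_add_iff (f := fun t : ℕ => 1 / (t : ℝ)) 1).not.2
    Real.not_summable_one_div_natCast

end RealSequences

section LipschitzDeriv

theorem le_quadratic_of_lipschitz_deriv {f : ℝ → ℝ} {β : ℝ≥0} (hf : Differentiable ℝ f)
    (hβ : LipschitzWith β (deriv f)) (a b : ℝ) :
    f b ≤ f a + deriv f a * (b - a) + β / 2 * (b - a) ^ 2 := by
  set gap : ℝ → ℝ := fun s => f a + deriv f a * (s - a) + β / 2 * (s - a) ^ 2 - f s with hgap
  have hderiv : ∀ s, HasDerivAt gap (deriv f a + β * (s - a) - deriv f s) s := fun s => by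
    have hsub : HasDerivAt (fun s : ℝ => s - a) 1 s := (hasDerivAt_id s).sub_const a
    refine ((((hsub.const_mul (deriv f a)).const_add (f a)).add
      ((hsub.pow 2).const_mul ((β : ℝ) / 2))).sub (hf s).hasDerivAt).congr_deriv ?_
    simp
    ring
  have hdiff : Differentiable ℝ gap := fun s => (hderiv s).differentiableAt
  have hlip : ∀ s, |deriv f s - deriv f a| ≤ β * |s - a| := fun s => by
    simpa [Real.dist_eq] using hβ.dist_le_mul s a
  suffices gap a ≤ gap b by simp only [hgap] at this; linarith
  rcases le_total a b with hab | hab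
  · refine monotoneOn_of_deriv_nonneg (convex_Ici a) hdiff.continuous.continuousOn
      hdiff.differentiableOn (fun s hs => ?_) Set.self_mem_Ici hab hab
    rw [interior_Ici] at hs
    rw [(hderiv s).deriv]
    have := hlip s
    rw [abs_of_pos (sub_pos.2 (Set.mem_Ioi.1 hs))] at this
    linarith [le_abs_self (deriv f s - deriv f a)]
  · refine antitoneOn_of_deriv_nonpos (convex_Iic a) hdiff.continuous.continuousOn
      hdiff.differentiableOn (fun s hs => ?_) hab Set.self_mem_Iic hab
    rw [interior_Iic] at hs
    rw [(hderiv s).deriv]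
    have := hlip s
    rw [abs_of_neg (sub_neg.2 (Set.mem_Iio.1 hs))] at this
    linarith [neg_abs_le (deriv f s - deriv f a)]

end LipschitzDeriv

section InnerProductSpace

variable {E : Type*} [NormedAddCommGroup E] [InnerProductSpace ℝ E] {s : Set E}

theorem eq_zero_of_mem_span_of_inner_eq_zero {r : E} (hr : r ∈ Submodule.span ℝ s)
    (h : ∀ x ∈ s, inner ℝ r x = 0) : r = 0 := by
  have hort : Submodule.span ℝ {r} ⟂ Submodule.span ℝ s :=
    Submodule.isOrtho_span.2 fun _ hu x hx => (Set.mem_singleton_iff.1 hu) ▸ h x hx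
  exact inner_self_eq_zero.1 (hort.inner_eq (Submodule.mem_span_singleton_self r) hr)

theorem exists_le_abs_inner_of_mem_span (hs : s.Finite) {R : ℝ} (hR : 0 < R) :
    ∃ ρ > 0, ∀ r ∈ Submodule.span ℝ s, R ≤ ‖r‖ → ∃ x ∈ s, ρ ≤ |inner ℝ r x| := by
  have := hs.fintype
  have := FiniteDimensional.span_of_finite ℝ hs
  let T : Submodule.span ℝ s →ₗ[ℝ] (s → ℝ) :=
    LinearMap.pi fun x => (innerₗ E (x : E)).domRestrict _
  have hT : LinearMap.ker T = ⊥ := LinearMap.ker_eq_bot'.2 fun r hr => Subtype.ext <|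
    eq_zero_of_mem_span_of_inner_eq_zero r.2 fun x hx => by
      simpa [T, real_inner_comm] using congrFun hr ⟨x, hx⟩
  obtain ⟨K, hK, hanti⟩ := T.exists_antilipschitzWith hT
  replace hK : (0 : ℝ) < K := hK
  refine ⟨R / K, by positivity, fun r hr hRr => ?_⟩
  by_contra! hsmall
  have hTr : ‖T ⟨r, hr⟩‖ < R / K := (pi_norm_lt_iff (by positivity)).2 fun x => by
    simpa [T, real_inner_comm] using hsmall x x.2
  have hle : ‖r‖ ≤ K * ‖T ⟨r, hr⟩‖ := by simpa using hanti.le_mul_dist ⟨r, hr⟩ 0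
  rw [lt_div_iff₀' hK] at hTr
  linarith

end InnerProductSpace

section SummableMoments

variable {Ω : Type*} {mΩ : MeasurableSpace Ω} {μ : Measure Ω}

theorem ae_summable_of_summable_integral {f : ℕ → Ω → ℝ} (hf : ∀ t, Integrable (f t) μ)
    (hnonneg : ∀ t ω, 0 ≤ f t ω) (hsum : Summable fun t => ∫ ω, f t ω ∂μ) :
    ∀ᵐ ω ∂μ, Summable fun t => f t ω := by
  have hnorm : ∀ t, eLpNorm (f t) 1 μ = ENNReal.ofReal (∫ ω, f t ω ∂μ) := fun t => by
    rw [eLpNorm_one_eq_lintegral_enorm, ← ofReal_integral_norm_eq_lintegral_enorm (hf t)]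
    simp only [Real.norm_of_nonneg (hnonneg t _)]
  have hfin : ∑' t, eLpNorm (f t) 1 μ ≠ ⊤ := by
    simp only [hnorm]
    exact hsum.tsum_ofReal_ne_top
  filter_upwards [summable_norm_of_tsum_eLpNorm_ne_top le_rfl
    (fun t => (hf t).aestronglyMeasurable) hfin] with ω hω
  exact hω.of_norm

variable [IsProbabilityMeasure μ] {ℱ : Filtration ℕ mΩ} {M : ℕ → Ω → ℝ}

theorem integral_mul_martingale_increment (hM : Martingale M ℱ μ) (hM₂ : ∀ t, MemLp (M t) 2 μ)
    (t : ℕ) : ∫ ω, (M t * (M (t + 1) - M t)) ω ∂μ = 0 := by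
  have hdiff : Integrable (M (t + 1) - M t) μ := (hM.integrable _).sub (hM.integrable _)
  have hcond : μ[M (t + 1) - M t | ℱ t] =ᵐ[μ] 0 := by
    filter_upwards [condExp_sub (hM.integrable (t + 1)) (hM.integrable t) (ℱ t),
      hM.condExp_ae_eq t.le_succ, hM.condExp_ae_eq le_rfl] with ω hsub hsucc hself
    rw [hsub, Pi.sub_apply, hsucc, hself, sub_self, Pi.zero_apply]
  have hpull := condExp_mul_of_stronglyMeasurable_left (hM.stronglyMeasurable t)
    ((hM₂ t).integrable_mul ((hM₂ (t + 1)).sub (hM₂ t))) hdiff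
  rw [← integral_condExp (ℱ.le t)]
  refine integral_eq_zero_of_ae ?_
  filter_upwards [hpull, hcond] with ω hω hzero
  rw [hω, Pi.mul_apply, hzero, Pi.zero_apply, mul_zero]

theorem integral_sq_martingale_succ (hM : Martingale M ℱ μ) (hM₂ : ∀ t, MemLp (M t) 2 μ) (t : ℕ) :
    ∫ ω, M (t + 1) ω ^ 2 ∂μ = ∫ ω, M t ω ^ 2 ∂μ + ∫ ω, (M (t + 1) ω - M t ω) ^ 2 ∂μ := by
  have hcross := ((hM₂ t).integrable_mul ((hM₂ (t + 1)).sub (hM₂ t))).const_mul 2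
  have hincr := ((hM₂ (t + 1)).sub (hM₂ t)).integrable_sq
  have hsum : Integrable (fun ω => (M (t + 1) - M t) ω ^ 2 +
      2 * (M t * (M (t + 1) - M t)) ω) μ := hincr.add hcross
  calc ∫ ω, M (t + 1) ω ^ 2 ∂μ
    _ = ∫ ω, (M t ω ^ 2 + ((M (t + 1) - M t) ω ^ 2 + 2 * (M t * (M (t + 1) - M t)) ω)) ∂μ := by
        congr 1 with ω
        simp only [Pi.sub_apply, Pi.mul_apply]
        ring
    _ = ∫ ω, M t ω ^ 2 ∂μ + ∫ ω, (M (t + 1) ω - M t ω) ^ 2 ∂μ := by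
        rw [integral_add (hM₂ t).integrable_sq hsum, integral_add hincr hcross,
          integral_const_mul, integral_mul_martingale_increment hM hM₂, mul_zero, add_zero]
        simp only [Pi.sub_apply]

theorem ae_exists_tendsto_of_summable_integral_increment_sq (hM : Martingale M ℱ μ)
    (hM₂ : ∀ t, MemLp (M t) 2 μ)
    (hsum : Summable fun t => ∫ ω, (M (t + 1) ω - M t ω) ^ 2 ∂μ) :
    ∀ᵐ ω ∂μ, ∃ m, Tendsto (fun t => M t ω) atTop (𝓝 m) := by
  set V := ∫ ω, M 0 ω ^ 2 ∂μ + ∑' t, ∫ ω, (M (t + 1) ω - M t ω) ^ 2 ∂μ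
  have hvar : ∀ t, ∫ ω, M t ω ^ 2 ∂μ ≤ V := by
    intro t
    have hpartial : ∫ ω, M t ω ^ 2 ∂μ = ∫ ω, M 0 ω ^ 2 ∂μ +
        ∑ s ∈ Finset.range t, ∫ ω, (M (s + 1) ω - M s ω) ^ 2 ∂μ := by
      induction t with
      | zero => simp
      | succ t ih => rw [integral_sq_martingale_succ hM hM₂, ih, Finset.sum_range_succ, add_assoc]
    rw [hpartial]
    exact add_le_add le_rfl
      (hsum.sum_le_tsum _ fun _ _ => integral_nonneg fun _ => sq_nonneg _)
  refine hM.submartingale.exists_ae_tendsto_of_bdd (R := (1 + V).toNNReal) fun t => ?_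
  rw [eLpNorm_one_eq_lintegral_enorm,
    ← ofReal_integral_norm_eq_lintegral_enorm (hM.integrable t)]
  refine ENNReal.ofReal_le_ofReal ?_
  calc ∫ ω, ‖M t ω‖ ∂μ
    _ ≤ ∫ ω, (1 + M t ω ^ 2) ∂μ := by
        refine integral_mono (hM.integrable t).norm
          ((integrable_const _).add (hM₂ t).integrable_sq) fun ω => ?_
        rw [Real.norm_eq_abs, ← sq_abs]
        nlinarith [sq_nonneg (|M t ω| - 1)]
    _ = 1 + ∫ ω, M t ω ^ 2 ∂μ := by
        rw [integral_add (integrable_const _) (hM₂ t).integrable_sq, integral_const,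
          probReal_univ, one_smul]
    _ ≤ 1 + V := by gcongr; exact hvar t

end SummableMoments

variable {N d : ℕ}

section Data

theorem dataMap_apply (X : Dataset N d) (c : EuclideanSpace ℝ (Fin N)) :
    dataMap X c = ∑ n, c n • X n := by
  simp [dataMap]

theorem adjoint_dataMap_apply (X : Dataset N d) (v : EuclideanSpace ℝ (Fin d)) (n : Fin N) :
    (dataMap X).adjoint v n = inner ℝ v (X n) := by
  have h := (dataMap X).adjoint_inner_left (EuclideanSpace.single n 1) v
  simpa [dataMap_apply, Pi.single_apply, EuclideanSpace.inner_single_right] using h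

theorem norm_sum_smul_sq_le (X : Dataset N d) (c : Fin N → ℝ) :
    ‖∑ n, c n • X n‖ ^ 2 ≤ sigmaMax X ^ 2 * ∑ n, c n ^ 2 := by
  have h := (dataMap X).le_opNorm (WithLp.toLp 2 c)
  rw [dataMap_apply] at h
  calc ‖∑ n, c n • X n‖ ^ 2 ≤ (sigmaMax X * ‖WithLp.toLp 2 c‖) ^ 2 := by gcongr; exact h
    _ = sigmaMax X ^ 2 * ∑ n, c n ^ 2 := by rw [mul_pow, EuclideanSpace.real_norm_sq_eq]

theorem norm_sum_mem_smul_sq_le (X : Dataset N d) (c : Fin N → ℝ) (S : Finset (Fin N)) :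
    ‖∑ n ∈ S, c n • X n‖ ^ 2 ≤ sigmaMax X ^ 2 * ∑ n ∈ S, c n ^ 2 := by
  simpa [ite_smul, ite_pow] using norm_sum_smul_sq_le X fun n => if n ∈ S then c n else 0

theorem sum_inner_sq_le (X : Dataset N d) (v : EuclideanSpace ℝ (Fin d)) :
    ∑ n, inner ℝ v (X n) ^ 2 ≤ sigmaMax X ^ 2 * ‖v‖ ^ 2 := by
  have h := (dataMap X).adjoint.le_opNorm v
  calc ∑ n, inner ℝ v (X n) ^ 2 = ‖(dataMap X).adjoint v‖ ^ 2 := by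
        simp [EuclideanSpace.real_norm_sq_eq, adjoint_dataMap_apply]
    _ ≤ (‖(dataMap X).adjoint‖ * ‖v‖) ^ 2 := by gcongr
    _ = sigmaMax X ^ 2 * ‖v‖ ^ 2 := by rw [LinearIsometryEquiv.norm_map, mul_pow, sigmaMax]

theorem norm_le_sigmaMax (X : Dataset N d) (n : Fin N) : ‖X n‖ ≤ sigmaMax X := by
  simpa [sigmaMax, dataMap_apply, Pi.single_apply] using
    (dataMap X).le_opNorm (EuclideanSpace.single n 1)

theorem sigmaMax_nonneg (X : Dataset N d) : 0 ≤ sigmaMax X := norm_nonneg _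

theorem iInf_inner_le_norm (X : Dataset N d) {w : EuclideanSpace ℝ (Fin d)} (hw : ‖w‖ = 1)
    (n : Fin N) : ⨅ n, inner ℝ w (X n) ≤ ‖X n‖ :=
  calc ⨅ n, inner ℝ w (X n) ≤ inner ℝ w (X n) := ciInf_le (Set.finite_range _).bddBelow n
    _ ≤ ‖w‖ * ‖X n‖ := real_inner_le_norm _ _
    _ = ‖X n‖ := by rw [hw, one_mul]

theorem margin_le_sigmaMax (X : Dataset N d) : margin X ≤ sigmaMax X := by
  refine Real.sSup_le ?_ (sigmaMax_nonneg X)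
  rintro _ ⟨w, hw, rfl⟩
  rcases isEmpty_or_nonempty (Fin N) with _ | ⟨⟨n⟩⟩
  · simpa using sigmaMax_nonneg X
  · exact (iInf_inner_le_norm X hw n).trans (norm_le_sigmaMax X n)

theorem margin_pos {X : Dataset N d} (hN : 0 < N) (hX : LinearlySeparable X) : 0 < margin X := by
  obtain ⟨w, hw⟩ := hX
  have : Nonempty (Fin N) := ⟨⟨0, hN⟩⟩
  have hw₀ : 0 < ‖w‖ := norm_pos_iff.2 fun h => by simpa [h] using hw ⟨0, hN⟩
  have hunit : ‖‖w‖⁻¹ • w‖ = 1 := by simp [norm_smul, hw₀.ne']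
  obtain ⟨n, hn⟩ := exists_eq_ciInf_of_finite (f := fun n => inner ℝ (‖w‖⁻¹ • w) (X n))
  have hpos : 0 < ⨅ n, inner ℝ (‖w‖⁻¹ • w) (X n) := by
    rw [← hn, real_inner_smul_left]
    exact mul_pos (inv_pos.2 hw₀) (hw n)
  refine hpos.trans_le (le_csSup ⟨‖X ⟨0, hN⟩‖, ?_⟩ ⟨_, hunit, rfl⟩)
  rintro _ ⟨v, hv, rfl⟩
  exact iInf_inner_le_norm X hv _

theorem margin_mul_sum_le (X : Dataset N d) {c : Fin N → ℝ} (hc : ∀ n, 0 ≤ c n) :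
    margin X * ∑ n, c n ≤ ‖∑ n, c n • X n‖ := by
  rcases (Finset.sum_nonneg fun n _ => hc n).eq_or_lt with hsum | hsum
  · rw [← hsum, mul_zero]
    exact norm_nonneg _
  rw [← le_div_iff₀ hsum]
  refine Real.sSup_le ?_ (by positivity)
  rintro _ ⟨w, hw, rfl⟩
  rw [le_div_iff₀ hsum]
  calc (⨅ n, inner ℝ w (X n)) * ∑ n, c n = ∑ n, (⨅ n, inner ℝ w (X n)) * c n :=
        Finset.mul_sum _ _ _
    _ ≤ ∑ n, inner ℝ w (X n) * c n := by
        gcongr with n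
        · exact hc n
        · exact ciInf_le (Set.finite_range _).bddBelow n
    _ = inner ℝ w (∑ n, c n • X n) := by simp only [inner_sum, inner_smul_right, mul_comm]
    _ ≤ ‖w‖ * ‖∑ n, c n • X n‖ := real_inner_le_norm _ _
    _ = ‖∑ n, c n • X n‖ := by rw [hw, one_mul]

theorem margin_sq_mul_sum_sq_le {X : Dataset N d} (hγ : 0 ≤ margin X) {c : Fin N → ℝ}
    (hc : ∀ n, 0 ≤ c n) : margin X ^ 2 * ∑ n, c n ^ 2 ≤ ‖∑ n, c n • X n‖ ^ 2 :=
  calc margin X ^ 2 * ∑ n, c n ^ 2 ≤ margin X ^ 2 * (∑ n, c n) ^ 2 := by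
        gcongr
        exact Finset.sum_sq_le_sq_sum_of_nonneg fun n _ => hc n
    _ = (margin X * ∑ n, c n) ^ 2 := (mul_pow _ _ _).symm
    _ ≤ ‖∑ n, c n • X n‖ ^ 2 :=
        pow_le_pow_left₀ (mul_nonneg hγ (Finset.sum_nonneg fun n _ => hc n))
          (margin_mul_sum_le X hc) 2

end Data

section Loss

variable {ℓ : ℝ → ℝ} {β : ℝ≥0}

theorem IsSmoothMonotoneLoss.smoothness_pos (hℓ : IsSmoothMonotoneLoss ℓ β) : 0 < β := by
  refine pos_iff_ne_zero.2 fun hβ => ?_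
  have hconst : deriv ℓ = fun _ => deriv ℓ 0 := funext fun u => by
    simpa [hβ] using hℓ.smooth.dist_le_mul u 0
  have hlim := hℓ.deriv_tendsto_zero
  rw [hconst] at hlim
  exact (hℓ.deriv_neg 0).ne (tendsto_nhds_unique tendsto_const_nhds hlim)

theorem IsSmoothMonotoneLoss.eventually_atBot_deriv_lt (hℓ : IsSmoothMonotoneLoss ℓ β) :
    ∃ c < 0, ∀ᶠ u in atBot, deriv ℓ u < c := by
  have hneg : limsup (fun u => ((deriv ℓ u : ℝ) : EReal)) atBot < 0 :=
    lt_of_le_of_ne (limsup_le_of_le (h := Eventually.of_forall fun u => by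
      exact_mod_cast (hℓ.deriv_neg u).le)) hℓ.limsup_ne
  obtain ⟨c, hlim, hc⟩ := EReal.lt_iff_exists_real_btwn.1 hneg
  exact ⟨c, by exact_mod_cast hc,
    (eventually_lt_of_limsup_lt hlim).mono fun u hu => by exact_mod_cast hu⟩

theorem IsSmoothMonotoneLoss.exists_deriv_le (hℓ : IsSmoothMonotoneLoss ℓ β) (M : ℝ) :
    ∃ c < 0, ∀ u ≤ M, deriv ℓ u ≤ c := by
  obtain ⟨c, hc, hatBot⟩ := hℓ.eventually_atBot_deriv_lt
  obtain ⟨A, hA⟩ := eventually_atBot.1 hatBot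
  obtain ⟨u₀, -, hu₀⟩ := isCompact_Icc.exists_isMaxOn
    (Set.nonempty_Icc.2 (min_le_right A M)) hℓ.smooth.continuous.continuousOn
  refine ⟨max c (deriv ℓ u₀), max_lt hc (hℓ.deriv_neg u₀), fun u hu => ?_⟩
  rcases le_total u A with h | h
  · exact (hA u h).le.trans (le_max_left _ _)
  · exact (hu₀ ⟨(min_le_left A M).trans h, hu⟩).trans (le_max_right _ _)

theorem IsSmoothMonotoneLoss.tendsto_atTop_of_deriv_tendsto_zero
    (hℓ : IsSmoothMonotoneLoss ℓ β) {ι : Type*} {l : Filter ι} {u : ι → ℝ}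
    (hu : Tendsto (fun i => deriv ℓ (u i)) l (𝓝 0)) : Tendsto u l atTop := by
  refine tendsto_atTop.2 fun M => ?_
  obtain ⟨c, hc, hM⟩ := hℓ.exists_deriv_le M
  filter_upwards [hu.eventually_const_lt hc] with i hi
  by_contra! hlt
  exact (hM _ hlt.le).not_gt hi

theorem HasTightExpTail.tendsto_mul_exp {f : ℝ → ℝ} (hf : HasTightExpTail f) :
    Tendsto (fun u => f u * Real.exp u) atTop (𝓝 1) := by
  obtain ⟨μp, μm, ubar, hp, hm, -, hbounds⟩ := hf
  have hexp : ∀ μ > 0, Tendsto (fun u : ℝ => Real.exp (-μ * u)) atTop (𝓝 0) := fun μ hμ =>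
    Real.tendsto_exp_atBot.comp (tendsto_id.const_mul_atTop_of_neg (neg_lt_zero.2 hμ))
  have hlower : Tendsto (fun u => 1 - Real.exp (-μm * u)) atTop (𝓝 1) := by
    simpa using tendsto_const_nhds.sub (hexp μm hm)
  have hupper : Tendsto (fun u => 1 + Real.exp (-μp * u)) atTop (𝓝 1) := by
    simpa using tendsto_const_nhds.add (hexp μp hp)
  refine tendsto_of_tendsto_of_tendsto_of_le_of_le' hlower hupper ?_ ?_
  all_goals
    filter_upwards [eventually_gt_atTop ubar] with u hu
    have hbound := hbounds u hu
    rw [Real.exp_neg, ← div_eq_mul_inv, ← div_eq_mul_inv, div_le_iff₀ (Real.exp_pos u),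
      le_div_iff₀ (Real.exp_pos u)] at hbound
  exacts [hbound.1, hbound.2]

end Loss

section EmpiricalLoss

variable {ℓ : ℝ → ℝ} {β : ℝ≥0}

/-- The empirical loss. -/
noncomputable def empLoss (X : Dataset N d) (ℓ : ℝ → ℝ) (w : EuclideanSpace ℝ (Fin d)) : ℝ :=
  ∑ n, ℓ (inner ℝ w (X n))

/-- The coefficient of the sample `x_n` in the negative gradient of the empirical loss. -/
noncomputable def gradCoeff (X : Dataset N d) (ℓ : ℝ → ℝ) (w : EuclideanSpace ℝ (Fin d))
    (n : Fin N) : ℝ :=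
  -deriv ℓ (inner ℝ w (X n))

/-- The negative gradient of the empirical loss. -/
noncomputable def negGrad (X : Dataset N d) (ℓ : ℝ → ℝ) (w : EuclideanSpace ℝ (Fin d)) :
    EuclideanSpace ℝ (Fin d) :=
  ∑ n, gradCoeff X ℓ w n • X n

theorem empLoss_nonneg (hℓ : IsSmoothMonotoneLoss ℓ β) (X : Dataset N d)
    (w : EuclideanSpace ℝ (Fin d)) : 0 ≤ empLoss X ℓ w :=
  Finset.sum_nonneg fun _ _ => (hℓ.pos _).le

theorem gradCoeff_pos (hℓ : IsSmoothMonotoneLoss ℓ β) (X : Dataset N d)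
    (w : EuclideanSpace ℝ (Fin d)) (n : Fin N) : 0 < gradCoeff X ℓ w n :=
  neg_pos.2 (hℓ.deriv_neg _)

theorem sum_gradCoeff_mul_inner (X : Dataset N d) (ℓ : ℝ → ℝ) (w v : EuclideanSpace ℝ (Fin d)) :
    ∑ n, gradCoeff X ℓ w n * inner ℝ v (X n) = inner ℝ (negGrad X ℓ w) v := by
  rw [negGrad, sum_inner]
  exact Finset.sum_congr rfl fun n _ => by rw [real_inner_smul_left, real_inner_comm]

theorem empLoss_add_le (hℓ : Differentiable ℝ ℓ) (hβ : LipschitzWith β (deriv ℓ))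
    (X : Dataset N d) (w v : EuclideanSpace ℝ (Fin d)) :
    empLoss X ℓ (w + v) ≤
      empLoss X ℓ w - inner ℝ (negGrad X ℓ w) v + β * sigmaMax X ^ 2 / 2 * ‖v‖ ^ 2 := by
  have hsample : ∀ n, ℓ (inner ℝ (w + v) (X n)) ≤ ℓ (inner ℝ w (X n)) -
      gradCoeff X ℓ w n * inner ℝ v (X n) + β / 2 * inner ℝ v (X n) ^ 2 := fun n => by
    have := le_quadratic_of_lipschitz_deriv hℓ hβ (inner ℝ w (X n)) (inner ℝ (w + v) (X n))
    rw [inner_add_left, add_sub_cancel_left, ← inner_add_left] at this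
    simpa only [gradCoeff, neg_mul, sub_neg_eq_add] using this
  calc empLoss X ℓ (w + v)
    _ ≤ ∑ n, (ℓ (inner ℝ w (X n)) - gradCoeff X ℓ w n * inner ℝ v (X n)
          + β / 2 * inner ℝ v (X n) ^ 2) := Finset.sum_le_sum fun n _ => hsample n
    _ = empLoss X ℓ w - inner ℝ (negGrad X ℓ w) v + β / 2 * ∑ n, inner ℝ v (X n) ^ 2 := by
        rw [Finset.sum_add_distrib, Finset.sum_sub_distrib, sum_gradCoeff_mul_inner,
          ← Finset.mul_sum, empLoss]
    _ ≤ empLoss X ℓ w - inner ℝ (negGrad X ℓ w) v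
          + β / 2 * (sigmaMax X ^ 2 * ‖v‖ ^ 2) := by
        gcongr
        exact sum_inner_sq_le X v
    _ = empLoss X ℓ w - inner ℝ (negGrad X ℓ w) v + β * sigmaMax X ^ 2 / 2 * ‖v‖ ^ 2 := by ring

theorem margin_sq_mul_sum_gradCoeff_sq_le (hℓ : IsSmoothMonotoneLoss ℓ β) {X : Dataset N d}
    (hγ : 0 ≤ margin X) (w : EuclideanSpace ℝ (Fin d)) :
    margin X ^ 2 * ∑ n, gradCoeff X ℓ w n ^ 2 ≤ ‖negGrad X ℓ w‖ ^ 2 :=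
  margin_sq_mul_sum_sq_le hγ fun n => (gradCoeff_pos hℓ X w n).le

theorem tendsto_gradCoeff_mul_exp (hℓ : IsSmoothMonotoneLoss ℓ β)
    (htail : Tendsto (fun u => -deriv ℓ u * Real.exp u) atTop (𝓝 1)) {X : Dataset N d}
    {v w : ℕ → EuclideanSpace ℝ (Fin d)} {n : Fin N}
    (hw : Summable fun t => gradCoeff X ℓ (w t) n ^ 2)
    (hvw : Tendsto (fun t => w t - v t) atTop (𝓝 0)) :
    Tendsto (fun t => gradCoeff X ℓ (w t) n * Real.exp (inner ℝ (v t) (X n))) atTop (𝓝 1) := by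
  have hmargin : Tendsto (fun t => inner ℝ (w t) (X n)) atTop atTop :=
    hℓ.tendsto_atTop_of_deriv_tendsto_zero <| by
      simpa [gradCoeff] using (tendsto_zero_of_summable_sq hw).neg
  have hshift := hvw.inner (𝕜 := ℝ) (tendsto_const_nhds (x := X n))
  rw [inner_zero_left] at hshift
  have hlim := (htail.comp hmargin).mul hshift.neg.rexp
  rw [neg_zero, Real.exp_zero, one_mul] at hlim
  refine hlim.congr fun t => ?_
  rw [Function.comp_apply, mul_assoc, ← Real.exp_add, inner_sub_left, gradCoeff]
  congr 2
  ring

end EmpiricalLoss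

section LogIncrement

variable {h : ℝ}

theorem log_mul_add_two (hh : h ≠ 0) (t : ℕ) :
    Real.log (h * ((t : ℝ) + 2)) =
      Real.log (h * ((t : ℝ) + 1)) + Real.log (1 + 1 / ((t : ℝ) + 1)) := by
  rw [← Real.log_mul (by positivity) (by positivity)]
  congr 1
  field_simp
  ring

theorem tendsto_mul_log_one_add_one_div :
    Tendsto (fun t : ℕ => ((t : ℝ) + 1) * Real.log (1 + 1 / ((t : ℝ) + 1))) atTop (𝓝 1) :=
  (Real.tendsto_mul_log_one_add_div_atTop 1).comp
    (tendsto_atTop_add_const_right _ 1 tendsto_natCast_atTop_atTop)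

theorem summable_log_one_add_one_div_sq :
    Summable fun t : ℕ => Real.log (1 + 1 / ((t : ℝ) + 1)) ^ 2 := by
  have hsum : Summable fun t : ℕ => (1 / ((t : ℝ) + 1)) ^ 2 := by
    simpa [inv_pow] using (summable_nat_add_iff 1).2 (Real.summable_one_div_nat_pow.2 one_lt_two)
  refine hsum.of_nonneg_of_le (fun t => sq_nonneg _) fun t => ?_
  have hpos : (0 : ℝ) ≤ 1 / ((t : ℝ) + 1) := by positivity
  have hle := Real.log_le_sub_one_of_pos (x := 1 + 1 / ((t : ℝ) + 1)) (by positivity)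
  exact pow_le_pow_left₀ (Real.log_nonneg (by linarith)) (by linarith) 2

theorem tendsto_log_mul_add_one (hh : 0 < h) :
    Tendsto (fun t : ℕ => Real.log (h * ((t : ℝ) + 1))) atTop atTop :=
  Real.tendsto_log_atTop.comp
    ((tendsto_atTop_add_const_right _ 1 tendsto_natCast_atTop_atTop).const_mul_atTop hh)

end LogIncrement

section LogAsymptotics

variable {X : Dataset N d} {what w0 wtilde : EuclideanSpace ℝ (Fin d)} {α : Fin N → ℝ} {h : ℝ}
  {p : ℕ → Fin N → ℝ} {v : ℕ → EuclideanSpace ℝ (Fin d)}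

theorem isResidualLimit_iff : IsResidualLimit X what α w0 wtilde ↔
    (∀ n ∈ supportIdx X what, Real.exp (-inner ℝ (X n) wtilde) = α n) ∧
      wtilde - w0 ∈ supportSpan X what := by
  rw [IsResidualLimit, sub_eq_zero, eq_comm (a := wtilde - w0),
    Submodule.starProjection_eq_self_iff]

/-- The data entering the asymptotics `w(t) = what log(…) + wtilde + o(1)` of a run started at
`w0`: a vector `what` separating with margin at least one, its dual variables `α`, support vectors
spanning the data, and the residual limit `wtilde`. -/
structure IsRegularLimit (X : Dataset N d) (what : EuclideanSpace ℝ (Fin d)) (α : Fin N → ℝ)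
    (w0 wtilde : EuclideanSpace ℝ (Fin d)) : Prop where
  one_le : ∀ n, 1 ≤ inner ℝ what (X n)
  dual : IsSVMDual X what α
  mem_span : ∀ n, X n ∈ supportSpan X what
  residual : IsResidualLimit X what α w0 wtilde

/-- A trajectory of `v(t+1) = v(t) + h ∑ n, p_n(t) x_n` whose nonnegative, square-summable
coefficients satisfy `p_n(t) ∼ exp(-v(t)ᵀ x_n)`, as for gradient descent on the exponential loss. -/
structure IsExpDriven (X : Dataset N d) (h : ℝ) (p : ℕ → Fin N → ℝ)
    (v : ℕ → EuclideanSpace ℝ (Fin d)) : Prop where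
  step : ∀ t, v (t + 1) = v t + h • ∑ n, p t n • X n
  nonneg : ∀ t n, 0 ≤ p t n
  tail : ∀ n, Tendsto (fun t => p t n * Real.exp (inner ℝ (v t) (X n))) atTop (𝓝 1)
  summable_sq : ∀ n, Summable fun t => p t n ^ 2

theorem IsRegularLimit.dual_pos (H : IsRegularLimit X what α w0 wtilde) {n : Fin N}
    (hn : n ∈ supportIdx X what) : 0 < α n :=
  H.residual.1 n hn ▸ Real.exp_pos _

theorem IsRegularLimit.sum_smul_mem (H : IsRegularLimit X what α w0 wtilde) (c : Fin N → ℝ) :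
    ∑ n, c n • X n ∈ supportSpan X what :=
  Submodule.sum_mem _ fun n _ => Submodule.smul_mem _ _ (H.mem_span n)

theorem IsRegularLimit.tendsto_exp_log_mul (H : IsRegularLimit X what α w0 wtilde) (hh : 0 < h)
    (n : Fin N) :
    Tendsto (fun t : ℕ => Real.exp (Real.log (h * ((t : ℝ) + 1)) * (1 - inner ℝ what (X n)) -
      inner ℝ (X n) wtilde)) atTop (𝓝 (α n)) := by
  by_cases hn : n ∈ supportIdx X what
  · have hone : inner ℝ what (X n) = 1 := hn
    simp only [hone, sub_self, mul_zero, zero_sub, H.residual.1 n hn, tendsto_const_nhds]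
  · rw [H.dual.2.1 n hn]
    have hlt : 1 - inner ℝ what (X n) < 0 := sub_neg.2 ((H.one_le n).lt_of_ne' hn)
    exact Real.tendsto_exp_atBot.comp (tendsto_atBot_add_const_right _ _
      ((tendsto_log_mul_add_one hh).atTop_mul_const_of_neg hlt))

/-- The distance of a trajectory from its asymptotics at time `t + 1`, the shift keeping the
logarithm away from `log 0`. -/
noncomputable def logResidual (h : ℝ) (what wtilde : EuclideanSpace ℝ (Fin d))
    (v : ℕ → EuclideanSpace ℝ (Fin d)) (t : ℕ) : EuclideanSpace ℝ (Fin d) :=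
  v (t + 1) - (Real.log (h * ((t : ℝ) + 1)) • what + wtilde)

/-- The coefficients of an exponentially driven trajectory relative to `exp (-r(t)ᵀ x_n) / (t+1)`,
with `r` the logarithmic residual. -/
noncomputable def scaledCoeff (X : Dataset N d) (h : ℝ) (p : ℕ → Fin N → ℝ)
    (r : ℕ → EuclideanSpace ℝ (Fin d)) (t : ℕ) (n : Fin N) : ℝ :=
  h * ((t : ℝ) + 1) * p (t + 1) n * Real.exp (inner ℝ (r t) (X n))

theorem IsExpDriven.logResidual_mem (hv : IsExpDriven X h p v)
    (H : IsRegularLimit X what α (v 0) wtilde) (t : ℕ) :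
    logResidual h what wtilde v t ∈ supportSpan X what := by
  have hwhat : what ∈ supportSpan X what := by
    have hmem := H.sum_smul_mem α
    rwa [← H.dual.2.2] at hmem
  have hv_mem : ∀ t, v t - wtilde ∈ supportSpan X what := fun t => by
    induction t with
    | zero => simpa using neg_mem (isResidualLimit_iff.1 H.residual).2
    | succ t ih =>
      rw [hv.step, add_sub_right_comm]
      exact add_mem ih (Submodule.smul_mem _ _ (H.sum_smul_mem _))
  have hsplit : logResidual h what wtilde v t =
      (v (t + 1) - wtilde) - Real.log (h * ((t : ℝ) + 1)) • what := by
    rw [logResidual]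
    abel
  rw [hsplit]
  exact sub_mem (hv_mem _) (Submodule.smul_mem _ _ hwhat)

theorem IsExpDriven.logResidual_succ (hv : IsExpDriven X h p v) (hh : h ≠ 0)
    (what wtilde : EuclideanSpace ℝ (Fin d)) (t : ℕ) :
    logResidual h what wtilde v (t + 1) = logResidual h what wtilde v t +
      (h • ∑ n, p (t + 1) n • X n - Real.log (1 + 1 / ((t : ℝ) + 1)) • what) := by
  have hcast : ((t + 1 : ℕ) : ℝ) + 1 = t + 2 := by push_cast; ring
  rw [logResidual, logResidual, hcast, log_mul_add_two hh, hv.step, add_smul]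
  abel

theorem IsExpDriven.tendsto_scaledCoeff (hv : IsExpDriven X h p v) (hh : 0 < h)
    (H : IsRegularLimit X what α w0 wtilde) (n : Fin N) :
    Tendsto (fun t => scaledCoeff X h p (logResidual h what wtilde v) t n) atTop (𝓝 (α n)) := by
  have hlim := ((hv.tail n).comp (tendsto_add_atTop_nat 1)).mul (H.tendsto_exp_log_mul hh n)
  rw [one_mul] at hlim
  refine hlim.congr fun t => ?_
  have hlog : h * ((t : ℝ) + 1) = Real.exp (Real.log (h * ((t : ℝ) + 1))) :=
    (Real.exp_log (by positivity)).symm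
  have hexp : inner ℝ (v (t + 1)) (X n) + (Real.log (h * ((t : ℝ) + 1)) *
      (1 - inner ℝ what (X n)) - inner ℝ (X n) wtilde) =
      Real.log (h * ((t : ℝ) + 1)) + inner ℝ (logResidual h what wtilde v t) (X n) := by
    rw [logResidual, inner_sub_left, inner_add_left, real_inner_smul_left,
      real_inner_comm wtilde (X n)]
    ring
  rw [scaledCoeff, Function.comp_apply, mul_assoc, ← Real.exp_add, hexp, Real.exp_add, ← hlog]
  ring

theorem inner_scaledCoeff_sub_log (hdual : IsSVMDual X what α)
    (r : ℕ → EuclideanSpace ℝ (Fin d)) (t : ℕ) :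
    inner ℝ (r t) (h • ∑ n, p (t + 1) n • X n - Real.log (1 + 1 / ((t : ℝ) + 1)) • what) =
      1 / ((t : ℝ) + 1) * ∑ n, inner ℝ (r t) (X n) *
        (scaledCoeff X h p r t n * Real.exp (-inner ℝ (r t) (X n)) -
          ((t : ℝ) + 1) * Real.log (1 + 1 / ((t : ℝ) + 1)) * α n) := by
  have hwhat : inner ℝ (r t) what = ∑ n, α n * inner ℝ (r t) (X n) := by
    conv_lhs => rw [hdual.2.2]
    simp only [inner_sum, inner_smul_right]
  simp only [inner_sub_right, inner_smul_right, inner_sum, hwhat, Finset.mul_sum,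
    ← Finset.sum_sub_distrib]
  refine Finset.sum_congr rfl fun n _ => ?_
  rw [scaledCoeff, mul_assoc (h * ((t : ℝ) + 1) * p (t + 1) n), ← Real.exp_add, add_neg_cancel,
    Real.exp_zero]
  field_simp

theorem IsExpDriven.summable_norm_increment_sq (hv : IsExpDriven X h p v)
    (what : EuclideanSpace ℝ (Fin d)) :
    Summable fun t : ℕ => ‖h • ∑ n, p (t + 1) n • X n -
      Real.log (1 + 1 / ((t : ℝ) + 1)) • what‖ ^ 2 := by
  have hcoeff : Summable fun t => ∑ n, p (t + 1) n ^ 2 :=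
    summable_sum fun n _ => (summable_nat_add_iff 1).2 (hv.summable_sq n)
  refine ((hcoeff.mul_left (2 * h ^ 2 * sigmaMax X ^ 2)).add
    (summable_log_one_add_one_div_sq.mul_left (2 * ‖what‖ ^ 2))).of_nonneg_of_le
    (fun t => by positivity) fun t => ?_
  set L := Real.log (1 + 1 / ((t : ℝ) + 1))
  calc ‖h • ∑ n, p (t + 1) n • X n - L • what‖ ^ 2
    _ ≤ (‖h • ∑ n, p (t + 1) n • X n‖ + ‖L • what‖) ^ 2 := by gcongr; exact norm_sub_le _ _
    _ ≤ 2 * (‖h • ∑ n, p (t + 1) n • X n‖ ^ 2 + ‖L • what‖ ^ 2) := add_sq_le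
    _ = 2 * (h ^ 2 * ‖∑ n, p (t + 1) n • X n‖ ^ 2 + L ^ 2 * ‖what‖ ^ 2) := by
        simp only [norm_smul, mul_pow, Real.norm_eq_abs, sq_abs]
    _ ≤ 2 * (h ^ 2 * (sigmaMax X ^ 2 * ∑ n, p (t + 1) n ^ 2) + L ^ 2 * ‖what‖ ^ 2) := by
        gcongr
        exact norm_sum_smul_sq_le X _
    _ = 2 * h ^ 2 * sigmaMax X ^ 2 * ∑ n, p (t + 1) n ^ 2 + 2 * ‖what‖ ^ 2 * L ^ 2 := by ring

theorem IsExpDriven.tendsto_logResidual (hv : IsExpDriven X h p v) (hh : 0 < h)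
    (H : IsRegularLimit X what α (v 0) wtilde) :
    Tendsto (logResidual h what wtilde v) atTop (𝓝 0) := by
  set r := logResidual h what wtilde v
  have hsucc : ∀ t, r (t + 1) = r t + _ := hv.logResidual_succ hh.ne' what wtilde
  have hscaled := hv.tendsto_scaledCoeff hh H
  have hscaled₀ : ∀ t n, 0 ≤ scaledCoeff X h p r t n := fun t n =>
    mul_nonneg (mul_nonneg (by positivity) (hv.nonneg _ n)) (Real.exp_pos _).le
  suffices hsq : Tendsto (fun t => ‖r t‖ ^ 2) atTop (𝓝 0) by
    rw [tendsto_zero_iff_norm_tendsto_zero]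
    simpa [Real.sqrt_sq] using hsq.sqrt
  refine tendsto_zero_of_drift (fun t => by positivity) (fun t => by positivity)
    (fun t => div_le_one_of_le₀ (by simp) (by positivity)) not_summable_one_div_succ
    (fun t => by positivity) (hv.summable_norm_increment_sq what)
    (b := fun t : ℕ => 2 * ∑ n, inner ℝ (r t) (X n) *
      (scaledCoeff X h p r t n * Real.exp (-inner ℝ (r t) (X n)) -
        ((t : ℝ) + 1) * Real.log (1 + 1 / ((t : ℝ) + 1)) * α n)) ?_ ?_ ?_
  · intro t
    rw [hsucc, norm_add_sq_real, inner_scaledCoeff_sub_log H.dual]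
    exact le_of_eq (by ring)
  · intro R hR
    filter_upwards [eventually_sum_exp_drift_le H.dual.1 hscaled hscaled₀
      tendsto_mul_log_one_add_one_div (half_pos hR)] with t ht
    linarith [ht fun n => inner ℝ (r t) (X n)]
  · intro R hR
    obtain ⟨ρ, hρ, hsupport⟩ := exists_le_abs_inner_of_mem_span
      ((supportIdx X what).toFinite.image X) (Real.sqrt_pos.2 hR)
    obtain ⟨c, hc, hneg⟩ := eventually_sum_exp_drift_le_neg H.dual.1 hscaled hscaled₀
      tendsto_mul_log_one_add_one_div hρ
    refine ⟨2 * c, by positivity, ?_⟩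
    filter_upwards [hneg] with t ht hRt
    obtain ⟨_, ⟨n, hn, rfl⟩, hρn⟩ := hsupport (r t) (hv.logResidual_mem H t)
      (Real.sqrt_le_iff.2 ⟨norm_nonneg _, hRt⟩)
    linarith [ht (fun n => inner ℝ (r t) (X n)) ⟨n, H.dual_pos hn, hρn⟩]

theorem IsExpDriven.tendsto_sub_log (hv : IsExpDriven X h p v) (hh : 0 < h)
    (H : IsRegularLimit X what α (v 0) wtilde) :
    Tendsto (fun t : ℕ => v t - (Real.log (h * t) • what + wtilde)) atTop (𝓝 0) :=
  (tendsto_add_atTop_iff_nat 1).1 <| (hv.tendsto_logResidual hh H).congr fun t => by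
    rw [logResidual, Nat.cast_add_one]

end LogAsymptotics

section PerturbedDescent

variable {X : Dataset N d} {ℓ : ℝ → ℝ} {β : ℝ≥0} {h : ℝ}

theorem empLoss_add_smul_le (hℓ : Differentiable ℝ ℓ) (hβ : LipschitzWith β (deriv ℓ))
    (hh : 0 ≤ h) {w g : EuclideanSpace ℝ (Fin d)} {ρ : ℝ}
    (hg : ‖g - negGrad X ℓ w‖ ≤ ρ * ‖negGrad X ℓ w‖) :
    empLoss X ℓ (w + h • g) ≤ empLoss X ℓ w -
      h * (1 - ρ - β * sigmaMax X ^ 2 / 2 * h * (1 + ρ) ^ 2) * ‖negGrad X ℓ w‖ ^ 2 := by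
  set G := negGrad X ℓ w
  have hinner : (1 - ρ) * ‖G‖ ^ 2 ≤ inner ℝ G g := by
    have hsplit : inner ℝ G g = ‖G‖ ^ 2 + inner ℝ G (g - G) := by
      rw [inner_sub_right, real_inner_self_eq_norm_sq]
      ring
    have herr : ‖G‖ * ‖g - G‖ ≤ ‖G‖ * (ρ * ‖G‖) := by gcongr
    linarith [neg_le_of_abs_le (abs_real_inner_le_norm G (g - G))]
  have hnorm : ‖g‖ ≤ (1 + ρ) * ‖G‖ := by linarith [norm_le_norm_add_norm_sub' g G]
  calc empLoss X ℓ (w + h • g)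
    _ ≤ empLoss X ℓ w - inner ℝ G (h • g) + β * sigmaMax X ^ 2 / 2 * ‖h • g‖ ^ 2 :=
        empLoss_add_le hℓ hβ X w _
    _ = empLoss X ℓ w - h * inner ℝ G g + β * sigmaMax X ^ 2 / 2 * (h * ‖g‖) ^ 2 := by
        rw [inner_smul_right, norm_smul, Real.norm_of_nonneg hh]
    _ ≤ empLoss X ℓ w - h * ((1 - ρ) * ‖G‖ ^ 2) +
          β * sigmaMax X ^ 2 / 2 * (h * ((1 + ρ) * ‖G‖)) ^ 2 := by gcongr
    _ = empLoss X ℓ w - h * (1 - ρ - β * sigmaMax X ^ 2 / 2 * h * (1 + ρ) ^ 2) * ‖G‖ ^ 2 := by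
        ring

end PerturbedDescent

section Epoch

variable {X : Dataset N d} {ℓ : ℝ → ℝ} {β : ℝ≥0} {h : ℝ} {K k : ℕ} {κ : Fin N → ℕ}
  {w : ℕ → EuclideanSpace ℝ (Fin d)}

/-- `w 0, …, w K` are the iterates of an epoch of gradient steps of size `h` in which every sample
`x_n` is used exactly once, at iteration `κ n`. -/
structure IsEpoch (X : Dataset N d) (ℓ : ℝ → ℝ) (h : ℝ) (K : ℕ) (κ : Fin N → ℕ)
    (w : ℕ → EuclideanSpace ℝ (Fin d)) : Prop where
  index_lt : ∀ n, κ n < K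
  step : ∀ k < K, w (k + 1) = w k + h • ∑ n with κ n = k, gradCoeff X ℓ (w k) n • X n

/-- The coefficient of the sample `x_n` in the total update of an epoch. -/
noncomputable def epochCoeff (X : Dataset N d) (ℓ : ℝ → ℝ) (κ : Fin N → ℕ)
    (w : ℕ → EuclideanSpace ℝ (Fin d)) (n : Fin N) : ℝ :=
  gradCoeff X ℓ (w (κ n)) n

theorem IsEpoch.eq_add_sum_lt (he : IsEpoch X ℓ h K κ w) (hk : k ≤ K) :
    w k = w 0 + h • ∑ n with κ n < k, epochCoeff X ℓ κ w n • X n := by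
  induction k with
  | zero => simp
  | succ k ih =>
    have hcoeff : ∑ n with κ n = k, gradCoeff X ℓ (w k) n • X n =
        ∑ n with κ n = k, epochCoeff X ℓ κ w n • X n :=
      Finset.sum_congr rfl fun n hn => by rw [epochCoeff, (Finset.mem_filter.1 hn).2]
    have hdisj : Disjoint (Finset.univ.filter fun n => κ n < k)
        (Finset.univ.filter fun n => κ n = k) :=
      Finset.disjoint_filter.2 fun n _ hlt => hlt.ne
    rw [he.step k hk, hcoeff, ih (Nat.le_of_succ_le hk), add_assoc, ← smul_add,
      ← Finset.sum_union hdisj, ← Finset.filter_or]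
    simp only [Nat.lt_succ_iff_lt_or_eq]

theorem IsEpoch.last_eq (he : IsEpoch X ℓ h K κ w) :
    w K = w 0 + h • ∑ n, epochCoeff X ℓ κ w n • X n := by
  simpa [he.index_lt] using he.eq_add_sum_lt le_rfl

theorem IsEpoch.norm_sub_sq_le (he : IsEpoch X ℓ h K κ w) (hk : k ≤ K) :
    ‖w k - w 0‖ ^ 2 ≤ h ^ 2 * sigmaMax X ^ 2 * ∑ n, epochCoeff X ℓ κ w n ^ 2 := by
  rw [he.eq_add_sum_lt hk, add_sub_cancel_left, norm_smul, mul_pow, Real.norm_eq_abs, sq_abs,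
    mul_assoc]
  gcongr
  refine (norm_sum_mem_smul_sq_le X _ _).trans ?_
  gcongr
  exact Finset.filter_subset _ _

theorem sum_epochCoeff_sub_sq_le_sum_range (hβ : LipschitzWith β (deriv ℓ))
    (hκ : ∀ n, κ n < K) :
    ∑ n, (epochCoeff X ℓ κ w n - gradCoeff X ℓ (w 0) n) ^ 2 ≤
      ∑ k ∈ Finset.range K, β ^ 2 * (sigmaMax X ^ 2 * ‖w k - w 0‖ ^ 2) := by
  have hsample : ∀ n, (epochCoeff X ℓ κ w n - gradCoeff X ℓ (w 0) n) ^ 2 ≤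
      ∑ k ∈ Finset.range K, (β : ℝ) ^ 2 * inner ℝ (w k - w 0) (X n) ^ 2 := fun n => by
    have hlip := hβ.dist_le_mul (inner ℝ (w (κ n)) (X n)) (inner ℝ (w 0) (X n))
    rw [Real.dist_eq, Real.dist_eq, ← inner_sub_left, abs_sub_comm] at hlip
    calc (epochCoeff X ℓ κ w n - gradCoeff X ℓ (w 0) n) ^ 2
      _ = |deriv ℓ (inner ℝ (w 0) (X n)) - deriv ℓ (inner ℝ (w (κ n)) (X n))| ^ 2 := by
          rw [sq_abs, epochCoeff, gradCoeff, gradCoeff, neg_sub_neg]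
      _ ≤ (β * |inner ℝ (w (κ n) - w 0) (X n)|) ^ 2 := by gcongr
      _ = β ^ 2 * inner ℝ (w (κ n) - w 0) (X n) ^ 2 := by rw [mul_pow, sq_abs]
      _ ≤ ∑ k ∈ Finset.range K, (β : ℝ) ^ 2 * inner ℝ (w k - w 0) (X n) ^ 2 :=
          Finset.single_le_sum (f := fun k => (β : ℝ) ^ 2 * inner ℝ (w k - w 0) (X n) ^ 2)
            (fun k _ => by positivity) (Finset.mem_range.2 (hκ n))
  calc ∑ n, (epochCoeff X ℓ κ w n - gradCoeff X ℓ (w 0) n) ^ 2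
    _ ≤ ∑ n, ∑ k ∈ Finset.range K, (β : ℝ) ^ 2 * inner ℝ (w k - w 0) (X n) ^ 2 :=
        Finset.sum_le_sum fun n _ => hsample n
    _ = ∑ k ∈ Finset.range K, (β : ℝ) ^ 2 * ∑ n, inner ℝ (w k - w 0) (X n) ^ 2 := by
        rw [Finset.sum_comm]
        simp only [Finset.mul_sum]
    _ ≤ ∑ k ∈ Finset.range K, β ^ 2 * (sigmaMax X ^ 2 * ‖w k - w 0‖ ^ 2) := by
        gcongr
        exact sum_inner_sq_le X _

theorem IsEpoch.sum_epochCoeff_sub_sq_le (he : IsEpoch X ℓ h K κ w)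
    (hβ : LipschitzWith β (deriv ℓ)) :
    ∑ n, (epochCoeff X ℓ κ w n - gradCoeff X ℓ (w 0) n) ^ 2 ≤
      (h * β * sigmaMax X ^ 2 * K) ^ 2 * ∑ n, epochCoeff X ℓ κ w n ^ 2 := by
  have hKsq : (K : ℝ) ≤ K ^ 2 := by exact_mod_cast Nat.le_self_pow two_ne_zero K
  calc ∑ n, (epochCoeff X ℓ κ w n - gradCoeff X ℓ (w 0) n) ^ 2
    _ ≤ ∑ k ∈ Finset.range K, β ^ 2 * (sigmaMax X ^ 2 * ‖w k - w 0‖ ^ 2) :=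
        sum_epochCoeff_sub_sq_le_sum_range hβ he.index_lt
    _ ≤ ∑ k ∈ Finset.range K, β ^ 2 * (sigmaMax X ^ 2 *
          (h ^ 2 * sigmaMax X ^ 2 * ∑ n, epochCoeff X ℓ κ w n ^ 2)) := by
        gcongr with k hk
        exact he.norm_sub_sq_le (Finset.mem_range.1 hk).le
    _ = K * ((h * β * sigmaMax X ^ 2) ^ 2 * ∑ n, epochCoeff X ℓ κ w n ^ 2) := by
        rw [Finset.sum_const, Finset.card_range, nsmul_eq_mul]
        ring
    _ ≤ K ^ 2 * ((h * β * sigmaMax X ^ 2) ^ 2 * ∑ n, epochCoeff X ℓ κ w n ^ 2) := by gcongr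
    _ = (h * β * sigmaMax X ^ 2 * K) ^ 2 * ∑ n, epochCoeff X ℓ κ w n ^ 2 := by ring

theorem IsEpoch.sum_epochCoeff_sq_le (he : IsEpoch X ℓ h K κ w) (hℓ : IsSmoothMonotoneLoss ℓ β)
    (hγ : 0 < margin X) (hh : 0 ≤ h) (hstep : h * β * sigmaMax X ^ 2 * K ≤ 1 / 2) :
    ∑ n, epochCoeff X ℓ κ w n ^ 2 ≤ (2 * (‖negGrad X ℓ (w 0)‖ / margin X)) ^ 2 := by
  have hsq : (h * β * sigmaMax X ^ 2 * K) ^ 2 ≤ (1 / 2) ^ 2 := by gcongr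
  have hdiff : ∑ n, (epochCoeff X ℓ κ w n - gradCoeff X ℓ (w 0) n) ^ 2 ≤
      1 / 4 * ∑ n, epochCoeff X ℓ κ w n ^ 2 :=
    (he.sum_epochCoeff_sub_sq_le hℓ.smooth).trans (by gcongr; linarith)
  have hsplit : ∑ n, epochCoeff X ℓ κ w n ^ 2 ≤ 2 * ∑ n, gradCoeff X ℓ (w 0) n ^ 2 +
      2 * ∑ n, (epochCoeff X ℓ κ w n - gradCoeff X ℓ (w 0) n) ^ 2 := by
    rw [Finset.mul_sum, Finset.mul_sum, ← Finset.sum_add_distrib]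
    gcongr with n
    linarith [sq_nonneg (epochCoeff X ℓ κ w n - 2 * gradCoeff X ℓ (w 0) n)]
  have hgrad : ∑ n, gradCoeff X ℓ (w 0) n ^ 2 ≤ (‖negGrad X ℓ (w 0)‖ / margin X) ^ 2 := by
    rw [div_pow, le_div_iff₀ (by positivity), mul_comm]
    exact margin_sq_mul_sum_gradCoeff_sq_le hℓ hγ.le _
  rw [mul_pow]
  linarith

/-- The relative error of the total update of an epoch as an approximation of `h` times the
negative gradient. -/
noncomputable def epochError (X : Dataset N d) (β : ℝ≥0) (h : ℝ) (K : ℕ) : ℝ :=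
  2 * (h * β * sigmaMax X ^ 2 * K) * sigmaMax X / margin X

theorem IsEpoch.norm_sum_sub_negGrad_le (he : IsEpoch X ℓ h K κ w)
    (hℓ : IsSmoothMonotoneLoss ℓ β) (hγ : 0 < margin X) (hh : 0 ≤ h)
    (hstep : h * β * sigmaMax X ^ 2 * K ≤ 1 / 2) :
    ‖∑ n, epochCoeff X ℓ κ w n • X n - negGrad X ℓ (w 0)‖ ≤
      epochError X β h K * ‖negGrad X ℓ (w 0)‖ := by
  have hσ := sigmaMax_nonneg X
  refine le_of_sq_le_sq ?_ (by unfold epochError; positivity)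
  rw [negGrad, ← Finset.sum_sub_distrib, ← negGrad]
  simp only [← sub_smul]
  calc ‖∑ n, (epochCoeff X ℓ κ w n - gradCoeff X ℓ (w 0) n) • X n‖ ^ 2
    _ ≤ sigmaMax X ^ 2 * ∑ n, (epochCoeff X ℓ κ w n - gradCoeff X ℓ (w 0) n) ^ 2 :=
        norm_sum_smul_sq_le X _
    _ ≤ sigmaMax X ^ 2 * ((h * β * sigmaMax X ^ 2 * K) ^ 2 *
          (2 * (‖negGrad X ℓ (w 0)‖ / margin X)) ^ 2) := by
        gcongr
        refine (he.sum_epochCoeff_sub_sq_le hℓ.smooth).trans ?_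
        gcongr
        exact he.sum_epochCoeff_sq_le hℓ hγ hh hstep
    _ = (epochError X β h K * ‖negGrad X ℓ (w 0)‖) ^ 2 := by
        rw [epochError]
        ring

theorem IsEpoch.empLoss_le (he : IsEpoch X ℓ h K κ w) (hℓ : IsSmoothMonotoneLoss ℓ β)
    (hγ : 0 < margin X) (hh : 0 ≤ h) (hstep : h * β * sigmaMax X ^ 2 * K ≤ 1 / 2) :
    empLoss X ℓ (w K) ≤ empLoss X ℓ (w 0) -
      h * (1 - epochError X β h K -
        β * sigmaMax X ^ 2 / 2 * h * (1 + epochError X β h K) ^ 2) *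
        ‖negGrad X ℓ (w 0)‖ ^ 2 := by
  rw [he.last_eq]
  exact empLoss_add_smul_le hℓ.differentiable hℓ.smooth hh
    (he.norm_sum_sub_negGrad_le hℓ hγ hh hstep)

theorem epochError_add_lt_one (hγ : 0 < margin X) (hβ : 0 < β)
    (hstep : h < margin X /
      (2 * β * sigmaMax X ^ 3 * (K + (margin X)⁻¹ * sigmaMax X))) :
    epochError X β h K + 2 * (h * β * sigmaMax X ^ 2) * (sigmaMax X / margin X) ^ 2 < 1 := by
  have hσ : 0 < sigmaMax X := hγ.trans_le (margin_le_sigmaMax X)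
  have hβ' : (0 : ℝ) < β := NNReal.coe_pos.2 hβ
  rw [lt_div_iff₀ (by positivity)] at hstep
  calc epochError X β h K + 2 * (h * β * sigmaMax X ^ 2) * (sigmaMax X / margin X) ^ 2
    _ = h * (2 * β * sigmaMax X ^ 3 * (K + (margin X)⁻¹ * sigmaMax X)) / margin X := by
        rw [epochError]
        field_simp
    _ < 1 := (div_lt_one hγ).2 hstep

theorem epoch_descent_rate_pos (hγ : 0 < margin X) (hβ : 0 < β) (hh : 0 < h)
    (hstep : h < margin X /
      (2 * β * sigmaMax X ^ 3 * (K + (margin X)⁻¹ * sigmaMax X))) :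
    0 < h * (1 - epochError X β h K -
      β * sigmaMax X ^ 2 / 2 * h * (1 + epochError X β h K) ^ 2) := by
  have hσ : 0 < sigmaMax X := hγ.trans_le (margin_le_sigmaMax X)
  have hρ : 0 ≤ epochError X β h K := by unfold epochError; positivity
  have hlt := epochError_add_lt_one hγ hβ hstep
  set ρ := epochError X β h K
  set P := h * β * sigmaMax X ^ 2 with hP
  have hP₀ : 0 ≤ P := by positivity
  have hratio : 1 ≤ (sigmaMax X / margin X) ^ 2 :=
    one_le_pow₀ ((one_le_div hγ).2 (margin_le_sigmaMax X))
  have hPρ : ρ + 2 * P < 1 := by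
    have := mul_le_mul_of_nonneg_left hratio (mul_nonneg zero_le_two hP₀)
    linarith
  have hsq : (1 + ρ) ^ 2 ≤ 2 ^ 2 := by gcongr; linarith
  have hquad : β * sigmaMax X ^ 2 / 2 * h * (1 + ρ) ^ 2 ≤ 2 * P :=
    calc β * sigmaMax X ^ 2 / 2 * h * (1 + ρ) ^ 2 = P / 2 * (1 + ρ) ^ 2 := by rw [hP]; ring
      _ ≤ P / 2 * 2 ^ 2 := by gcongr
      _ = 2 * P := by ring
  exact mul_pos hh (by linarith)

end Epoch

section WithoutReplacement

variable {X : Dataset N d} {what w0 wtilde : EuclideanSpace ℝ (Fin d)} {α : Fin N → ℝ}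
  {ℓ : ℝ → ℝ} {β : ℝ≥0} {h : ℝ} {K : ℕ} {κ : ℕ → Fin N → ℕ} {w : ℕ → EuclideanSpace ℝ (Fin d)}

theorem SamplingWithoutReplacement.exists_index {B : ℕ} (hBK : B * K = N)
    {batch : ℕ → Finset (Fin N)} (hs : SamplingWithoutReplacement B K batch) (u : ℕ) :
    ∃ κ : Fin N → ℕ, (∀ n, κ n < K) ∧ ∀ k < K, ∀ n, n ∈ batch (K * u + k) ↔ κ n = k := by
  choose κ hκ hmem using hs.cover u
  -- The `K` batches have `N` members in total, so covering the data forces them to be disjoint.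
  have hbij : Function.Bijective
      fun p : (k : Fin K) × batch (K * u + k) => (p.2 : Fin N) :=
    (Fintype.bijective_iff_surjective_and_card _).2
      ⟨fun n => ⟨⟨⟨κ n, hκ n⟩, n, hmem n⟩, rfl⟩, by simp [hs.card_eq, mul_comm, ← hBK]⟩
  refine ⟨κ, hκ, fun k hk n => ⟨fun hn => ?_, by rintro rfl; exact hmem n⟩⟩
  have heq := hbij.1 (a₁ := ⟨⟨κ n, hκ n⟩, n, hmem n⟩) (a₂ := ⟨⟨k, hk⟩, n, hn⟩) rfl
  exact congrArg (fun p => p.1.1) heq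

theorem sgd_succ (X : Dataset N d) (ℓ : ℝ → ℝ) (η : ℝ) (B : ℕ) (batch : ℕ → Finset (Fin N))
    (w0 : EuclideanSpace ℝ (Fin d)) (t : ℕ) :
    sgd X ℓ η B batch w0 (t + 1) = sgd X ℓ η B batch w0 t +
      (η / B) • ∑ n ∈ batch t, gradCoeff X ℓ (sgd X ℓ η B batch w0 t) n • X n := by
  simp only [sgd, gradCoeff, neg_smul, Finset.sum_neg_distrib, smul_neg, sub_eq_add_neg]

theorem SamplingWithoutReplacement.exists_isEpoch {B : ℕ} (hBK : B * K = N)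
    {batch : ℕ → Finset (Fin N)} (hs : SamplingWithoutReplacement B K batch) (ℓ : ℝ → ℝ) (η : ℝ)
    (X : Dataset N d) (w0 : EuclideanSpace ℝ (Fin d)) :
    ∃ κ : ℕ → Fin N → ℕ, ∀ u,
      IsEpoch X ℓ (η / B) K (κ u) fun k => sgd X ℓ η B batch w0 (K * u + k) := by
  choose κ hκ hmem using hs.exists_index hBK
  refine ⟨κ, fun u => ⟨hκ u, fun k hk => ?_⟩⟩
  rw [← add_assoc, sgd_succ]
  congr 3
  ext n
  simp [hmem u k hk]

theorem summable_epochCoeff_sq (hw : ∀ u, IsEpoch X ℓ h K (κ u) fun k => w (K * u + k))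
    (hℓ : IsSmoothMonotoneLoss ℓ β) (hγ : 0 < margin X) (hh : 0 < h)
    (hstep : h * β * sigmaMax X ^ 2 * K ≤ 1 / 2)
    (hstep' : h < margin X /
      (2 * β * sigmaMax X ^ 3 * (K + (margin X)⁻¹ * sigmaMax X))) :
    Summable fun u => ∑ n, epochCoeff X ℓ (κ u) (fun k => w (K * u + k)) n ^ 2 := by
  have hgrad : Summable fun u => ‖negGrad X ℓ (w (K * u))‖ ^ 2 :=
    summable_of_descent (epoch_descent_rate_pos hγ hℓ.smoothness_pos hh hstep')
      (fun u => empLoss_nonneg hℓ X (w (K * u))) (fun u => by positivity)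
      fun u => (hw u).empLoss_le hℓ hγ hh.le hstep
  refine (hgrad.mul_left (2 ^ 2 / margin X ^ 2)).of_nonneg_of_le (fun u => by positivity)
    fun u => ((hw u).sum_epochCoeff_sq_le hℓ hγ hh.le hstep).trans_eq ?_
  rw [add_zero]
  ring

theorem tendsto_sub_epochStart (hw : ∀ u, IsEpoch X ℓ h K (κ u) fun k => w (K * u + k))
    (hsum : Summable fun u => ∑ n, epochCoeff X ℓ (κ u) (fun k => w (K * u + k)) n ^ 2)
    {ι : Type*} {l : Filter ι} {u k : ι → ℕ} (hu : Tendsto u l atTop) (hk : ∀ i, k i ≤ K) :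
    Tendsto (fun i => w (K * u i + k i) - w (K * u i)) l (𝓝 0) := by
  have hsmall : Tendsto (fun i => √(h ^ 2 * sigmaMax X ^ 2 *
      ∑ n, epochCoeff X ℓ (κ (u i)) (fun k => w (K * u i + k)) n ^ 2)) l (𝓝 0) := by
    simpa using ((hsum.tendsto_atTop_zero.comp hu).const_mul (h ^ 2 * sigmaMax X ^ 2)).sqrt
  exact squeeze_zero_norm
    (fun i => Real.le_sqrt_of_sq_le ((hw (u i)).norm_sub_sq_le (hk i))) hsmall

theorem isExpDriven_epochStart (hw : ∀ u, IsEpoch X ℓ h K (κ u) fun k => w (K * u + k))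
    (hℓ : IsSmoothMonotoneLoss ℓ β)
    (htail : Tendsto (fun u => -deriv ℓ u * Real.exp u) atTop (𝓝 1))
    (hsum : Summable fun u => ∑ n, epochCoeff X ℓ (κ u) (fun k => w (K * u + k)) n ^ 2) :
    IsExpDriven X h (fun u => epochCoeff X ℓ (κ u) fun k => w (K * u + k)) fun u => w (K * u) := by
  have hsum_n : ∀ n, Summable fun u =>
      epochCoeff X ℓ (κ u) (fun k => w (K * u + k)) n ^ 2 := fun n =>
    hsum.of_nonneg_of_le (fun u => sq_nonneg _) fun u =>
      Finset.single_le_sum (fun n _ => sq_nonneg _) (Finset.mem_univ n)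
  refine ⟨fun u => (hw u).last_eq, fun u n => (gradCoeff_pos hℓ X _ n).le, fun n => ?_, hsum_n⟩
  exact tendsto_gradCoeff_mul_exp hℓ htail (hsum_n n)
    (tendsto_sub_epochStart hw hsum tendsto_id fun u => ((hw u).index_lt n).le)

theorem tendsto_sub_log_of_isEpoch (hw : ∀ u, IsEpoch X ℓ h K (κ u) fun k => w (K * u + k))
    (hℓ : IsSmoothMonotoneLoss ℓ β)
    (htail : Tendsto (fun u => -deriv ℓ u * Real.exp u) atTop (𝓝 1))
    (hsum : Summable fun u => ∑ n, epochCoeff X ℓ (κ u) (fun k => w (K * u + k)) n ^ 2)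
    (hh : 0 < h) (hK : 0 < K) (H : IsRegularLimit X what α (w 0) wtilde) :
    Tendsto (fun t : ℕ => w t - (Real.log (h * (t / K)) • what + wtilde)) atTop (𝓝 0) := by
  have hdiv : Tendsto (fun t : ℕ => t / K) atTop atTop := Nat.tendsto_div_const_atTop hK.ne'
  have hstart : Tendsto (fun t : ℕ => w (K * (t / K)) -
      (Real.log (h * (t / K : ℕ)) • what + wtilde)) atTop (𝓝 0) :=
    ((isExpDriven_epochStart hw hℓ htail hsum).tendsto_sub_log hh H).comp hdiv
  have hwithin : Tendsto (fun t => w t - w (K * (t / K))) atTop (𝓝 0) := by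
    simpa only [Nat.div_add_mod] using
      tendsto_sub_epochStart hw hsum hdiv fun t => (Nat.mod_lt t hK).le
  have hlog : Tendsto (fun t : ℕ => Real.log (h * (t / K : ℕ)) - Real.log (h * (t / K)))
      atTop (𝓝 0) := by
    simpa only [Nat.floor_div_eq_div] using tendsto_log_mul_floor_sub hh.ne'
      (tendsto_natCast_atTop_atTop.atTop_div_const (Nat.cast_pos.2 hK))
  have hlim := (hwithin.add hstart).add (hlog.smul_const what)
  simp only [add_zero, zero_smul] at hlim
  refine hlim.congr fun t => ?_
  rw [sub_smul]
  abel

theorem IsRegularLimit.margin_pos (H : IsRegularLimit X what α w0 wtilde) (hN : 0 < N) :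
    0 < margin X :=
  MinibatchSGD.margin_pos hN ⟨what, fun n => one_pos.trans_le (H.one_le n)⟩

theorem hasLogAsymptotics_of_caseWithout (hN : 0 < N) (H : IsRegularLimit X what α w0 wtilde)
    (hℓ : IsSmoothMonotoneLoss ℓ β)
    (htail : Tendsto (fun u => -deriv ℓ u * Real.exp u) atTop (𝓝 1))
    {η : ℝ} {B : ℕ} {batch : ℕ → Finset (Fin N)} (hcase : CaseWithout X β η B K batch) :
    HasLogAsymptotics (sgd X ℓ η B batch w0) what wtilde η B K := by
  obtain ⟨hη, rfl, hstep, hsampling⟩ := hcase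
  obtain ⟨κ, hw⟩ := hsampling.exists_isEpoch rfl ℓ η X w0
  have hγ := H.margin_pos hN
  have hσ : 0 < sigmaMax X := hγ.trans_le (margin_le_sigmaMax X)
  have hβ : (0 : ℝ) < β := NNReal.coe_pos.2 hℓ.smoothness_pos
  have hB : 0 < B := Nat.pos_of_mul_pos_right hN
  have hK : 0 < K := Nat.pos_of_mul_pos_left hN
  have hh : 0 < η / B := by positivity
  have hhalf : η / B * β * sigmaMax X ^ 2 * K ≤ 1 / 2 := by
    have := (lt_div_iff₀ (by positivity)).1 (hstep.trans_le (min_le_left _ _))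
    linarith
  exact tendsto_sub_log_of_isEpoch hw hℓ htail
    (summable_epochCoeff_sq hw hℓ hγ hh hhalf (hstep.trans_le (min_le_right _ _))) hh hK H

end WithoutReplacement

section Gram

variable {ι E : Type*} [Fintype ι] [NormedAddCommGroup E] [InnerProductSpace ℝ E]

open Classical in
/-- For a linearly independent family `v`, the vector of its span with prescribed inner products
`y` with the members of the family. The explicit formula makes it measurable in `v`. -/
noncomputable def gramSolve (v : ι → E) (y : ι → ℝ) : E :=
  ∑ i, ((Matrix.gram ℝ v)⁻¹.mulVec y) i • v i

theorem gramSolve_mem_span (v : ι → E) (y : ι → ℝ) :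
    gramSolve v y ∈ Submodule.span ℝ (Set.range v) :=
  Submodule.sum_mem _ fun i _ => Submodule.smul_mem _ _ (Submodule.subset_span ⟨i, rfl⟩)

theorem inner_gramSolve {v : ι → E} (hv : LinearIndependent ℝ v) (y : ι → ℝ) (j : ι) :
    inner ℝ (gramSolve v y) (v j) = y j := by
  classical
  have hdet : IsUnit (Matrix.gram ℝ v).det :=
    isUnit_iff_ne_zero.2 (Matrix.det_gram_ne_zero_iff_linearIndependent.2 hv)
  calc inner ℝ (gramSolve v y) (v j)
      = (Matrix.gram ℝ v).mulVec ((Matrix.gram ℝ v)⁻¹.mulVec y) j := by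
        rw [gramSolve, sum_inner, Matrix.mulVec, dotProduct]
        refine Finset.sum_congr rfl fun i _ => ?_
        rw [real_inner_smul_left, Matrix.gram_apply, real_inner_comm, mul_comm]
    _ = y j := by rw [Matrix.mulVec_mulVec, Matrix.mul_nonsing_inv _ hdet, Matrix.one_mulVec]

theorem measurable_gramSolve {Ω : Type*} [MeasurableSpace Ω] [MeasurableSpace E] [BorelSpace E]
    [SecondCountableTopology E] {v : Ω → ι → E} (hv : ∀ i, Measurable fun ω => v ω i)
    (y : ι → ℝ) : Measurable fun ω => gramSolve (v ω) y := by
  classical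
  have hgram : Measurable fun ω => (fun i j => inner ℝ (v ω i) (v ω j) : ι → ι → ℝ) :=
    measurable_pi_lambda _ fun i => measurable_pi_lambda _ fun j => (hv i).inner (hv j)
  have hdet : Measurable fun ω => (Matrix.gram ℝ (v ω)).det :=
    (show Continuous fun M : ι → ι → ℝ => (Matrix.of M).det from
      Continuous.matrix_det continuous_id).measurable.comp hgram
  have hadj (i j : ι) : Measurable fun ω => (Matrix.gram ℝ (v ω)).adjugate i j :=
    (show Continuous fun M : ι → ι → ℝ => (Matrix.of M).adjugate i j from
      (Continuous.matrix_adjugate continuous_id).matrix_elem i j).measurable.comp hgram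
  simp only [gramSolve, Matrix.mulVec, dotProduct, Matrix.inv_def, Ring.inverse_eq_inv',
    Matrix.smul_apply, smul_eq_mul]
  exact Finset.measurable_sum _ fun i _ => Measurable.smul
    (Finset.measurable_sum _ fun j _ => (hdet.inv.mul (hadj i j)).mul_const _) (hv i)

end Gram

section GenericPosition

theorem addHaar_setOf_inner_eq {E : Type*} [NormedAddCommGroup E] [InnerProductSpace ℝ E]
    [FiniteDimensional ℝ E] [MeasurableSpace E] [BorelSpace E] (μ : Measure E)
    [μ.IsAddHaarMeasure] (v : E) {c : ℝ} (hc : c ≠ 0) : μ {x | inner ℝ v x = c} = 0 := by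
  let s : AffineSubspace ℝ E :=
    { carrier := {x | inner ℝ v x = c}
      smul_vsub_vadd_mem' := by
        intro a p₁ p₂ p₃ h₁ h₂ h₃
        simp only [Set.mem_ofPred_eq] at h₁ h₂ h₃ ⊢
        simp [inner_add_right, inner_smul_right, inner_sub_right, h₁, h₂, h₃] }
  refine Measure.addHaar_affineSubspace μ s fun hs => hc ?_
  have h_zero : (0 : E) ∈ s := hs ▸ AffineSubspace.mem_top _ _ _
  have h_inner : inner ℝ v (0 : E) = c := h_zero
  rw [← h_inner, inner_zero_right]

-- Fubini: with the other samples fixed, `x_m` avoids a fixed affine hyperplane.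
theorem ae_inner_ne_of_update_eq {m : Fin N} {f : Dataset N d → EuclideanSpace ℝ (Fin d)}
    (hf : Measurable f) (hfm : ∀ X x, f (Function.update X m x) = f X) {c : ℝ} (hc : c ≠ 0) :
    ∀ᵐ X : Dataset N d, inner ℝ (f X) (X m) ≠ c := by
  obtain ⟨n, rfl⟩ : ∃ n, N = n + 1 := ⟨N - 1, by have := m.2; omega⟩
  let T : Set (Dataset (n + 1) d) := {X | inner ℝ (f X) (X m) = c}
  have hT : MeasurableSet T :=
    (hf.inner (measurable_pi_apply m)) (measurableSet_singleton c)
  suffices volume T = 0 by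
    rw [ae_iff]
    simpa [T] using this
  have hmp := (volume_preserving_piFinSuccAbove
    (fun _ : Fin (n + 1) => EuclideanSpace ℝ (Fin d)) m).symm
  rw [← hmp.measure_preimage hT.nullMeasurableSet]
  change (volume.prod volume) _ = 0
  rw [Measure.prod_apply_symm (hmp.measurable hT)]
  refine (lintegral_congr fun Y => ?_).trans lintegral_zero
  refine measure_mono_null (fun x hx => ?_)
    (addHaar_setOf_inner_eq volume (f (m.insertNth 0 Y)) hc)
  have hinner : inner ℝ (f (m.insertNth x Y)) ((m.insertNth x Y : Dataset (n + 1) d) m) = c := hx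
  have hupdate : m.insertNth x Y = Function.update (m.insertNth 0 Y : Dataset (n + 1) d) m x :=
    (Fin.update_insertNth (α := fun _ => EuclideanSpace ℝ (Fin d)) m 0 x Y).symm
  rwa [hupdate, hfm, Function.update_self] at hinner

/-- Genericity of a dataset: `x_m` does not lie on the margin hyperplane determined by any set of
other samples. -/
def IsGeneric (X : Dataset N d) : Prop :=
  ∀ (A : Finset (Fin N)) (m : Fin N), m ∉ A →
    inner ℝ (gramSolve (fun i : A => X i) 1) (X m) ≠ 1

theorem ae_isGeneric : ∀ᵐ X : Dataset N d, IsGeneric X := by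
  simp only [IsGeneric, ae_all_iff]
  intro A m hm
  refine ae_inner_ne_of_update_eq
    (measurable_gramSolve (fun i : A => measurable_pi_apply (i : Fin N)) 1) (fun X x => ?_)
    one_ne_zero
  congr 1
  ext1 i
  exact Function.update_of_ne (ne_of_mem_of_not_mem i.2 hm) _ _

end GenericPosition

section ConvexHull

variable {ι E : Type*} [NormedAddCommGroup E] [InnerProductSpace ℝ E]

theorem exists_mem_convexHull_forall_norm_sq_le_inner {s : Set E} (hs : s.Finite)
    (hne : s.Nonempty) : ∃ p ∈ convexHull ℝ s, ∀ x ∈ s, ‖p‖ ^ 2 ≤ inner ℝ p x := by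
  have hconv : Convex ℝ (convexHull ℝ s) := convex_convexHull ℝ s
  obtain ⟨p, hp_mem, hp⟩ := exists_norm_eq_iInf_of_complete_convex hne.convexHull
    (hs.isCompact_convexHull ℝ).isComplete hconv 0
  rw [norm_eq_iInf_iff_real_inner_le_zero hconv hp_mem] at hp
  refine ⟨p, hp_mem, fun x hx => ?_⟩
  have hle := hp x (subset_convexHull ℝ s hx)
  rw [zero_sub, inner_neg_left, inner_sub_right, real_inner_self_eq_norm_sq] at hle
  linarith

theorem linearIndependent_of_affineIndependent_of_inner_eq {x : ι → E}
    (hx : AffineIndependent ℝ x) {p : E} {r : ℝ} (hr : r ≠ 0) (hp : ∀ i, inner ℝ p (x i) = r) :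
    LinearIndependent ℝ x := by
  refine linearIndependent_iff'.2 fun s g hg => affineIndependent_iff.1 hx s g ?_ hg
  have hmul : (∑ i ∈ s, g i) * r = 0 := by
    calc (∑ i ∈ s, g i) * r = inner ℝ p (∑ i ∈ s, g i • x i) := by
          simp only [inner_sum, inner_smul_right, hp, Finset.sum_mul]
      _ = 0 := by rw [hg, inner_zero_right]
  exact (mul_eq_zero.1 hmul).resolve_right hr

variable [Fintype ι]

theorem exists_affineIndependent_support_of_mem_convexHull_range {x : ι → E} {p : E}
    (hp : p ∈ convexHull ℝ (Set.range x)) :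
    ∃ c : ι → ℝ, (∀ i, 0 ≤ c i) ∧ ∑ i, c i = 1 ∧ ∑ i, c i • x i = p ∧
      AffineIndependent ℝ (fun i : Function.support c => x i) := by
  obtain ⟨κ, _, z, b, hz, haff, hb_pos, hb_sum, hb_comb⟩ := eq_pos_convex_span_of_mem_convexHull hp
  choose e he using fun j => hz ⟨j, rfl⟩
  have he_inj : Function.Injective e := fun i j h => haff.injective (by rw [← he, ← he, h])
  let c : ι → ℝ := Function.extend e b fun _ => 0
  have hc_range (j : κ) : c (e j) = b j := he_inj.extend_apply _ _ j
  have hc_compl (i : ι) (hi : i ∉ Set.range e) : c i = 0 := Function.extend_apply' _ _ i hi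
  have hsupp (i : Function.support c) : ∃ j, e j = i := by_contra fun hi => i.2 (hc_compl i hi)
  choose j hj using hsupp
  have hj_inj : Function.Injective j := fun a b h => Subtype.ext (by rw [← hj, ← hj, h])
  refine ⟨c, fun i => ?_, ?_, ?_, ?_⟩
  · by_cases hi : i ∈ Set.range e
    · obtain ⟨k, rfl⟩ := hi
      exact (hc_range k).symm ▸ (hb_pos k).le
    · exact (hc_compl i hi).ge
  · rw [← hb_sum]
    exact (Fintype.sum_of_injective e he_inj _ _ hc_compl fun k => (hc_range k).symm).symm
  · rw [← hb_comb]
    exact (Fintype.sum_of_injective e he_inj _ _ (fun i hi => by rw [hc_compl i hi, zero_smul])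
      fun k => by rw [hc_range, he]).symm
  · have hcomp : (fun i : Function.support c => x i) = z ∘ j := by
      ext1 i
      rw [Function.comp_apply, ← he, hj]
    rw [hcomp]
    exact haff.comp_embedding ⟨j, hj_inj⟩

theorem inner_eq_norm_sq_of_norm_sq_le_inner {x : ι → E} {c : ι → ℝ} {p : E}
    (hc : ∀ i, 0 ≤ c i) (hsum : ∑ i, c i = 1) (hp : ∑ i, c i • x i = p)
    (hle : ∀ i, ‖p‖ ^ 2 ≤ inner ℝ p (x i)) {i : ι} (hi : c i ≠ 0) :
    inner ℝ p (x i) = ‖p‖ ^ 2 := by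
  have heq : ∑ i, c i * ‖p‖ ^ 2 = ∑ i, c i * inner ℝ p (x i) := by
    calc ∑ i, c i * ‖p‖ ^ 2 = inner ℝ p p := by
          rw [← Finset.sum_mul, hsum, one_mul, real_inner_self_eq_norm_sq]
      _ = inner ℝ p (∑ i, c i • x i) := by rw [hp]
      _ = ∑ i, c i * inner ℝ p (x i) := by simp only [inner_sum, inner_smul_right]
  have hterm := (Finset.sum_eq_sum_iff_of_le fun i _ =>
    mul_le_mul_of_nonneg_left (hle i) (hc i)).1 heq i (Finset.mem_univ i)
  exact (mul_left_cancel₀ hi hterm).symm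

end ConvexHull

section Duality

variable {X : Dataset N d} {what : EuclideanSpace ℝ (Fin d)} {α : Fin N → ℝ}

-- `what` is the point of the convex hull closest to the origin, rescaled; Carathéodory's theorem
-- lets us write it with affinely independent samples, which then lie on a hyperplane off `0`.
theorem exists_isSVMDual_linearIndepOn (hN : 0 < N) (hX : LinearlySeparable X) :
    ∃ (what : EuclideanSpace ℝ (Fin d)) (α : Fin N → ℝ), (∀ n, 1 ≤ inner ℝ what (X n)) ∧
      IsSVMDual X what α ∧ LinearIndepOn ℝ X (Function.support α) := by
  obtain ⟨p, hp_mem, hp_le⟩ := exists_mem_convexHull_forall_norm_sq_le_inner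
    (Set.finite_range X) ⟨X ⟨0, hN⟩, ⟨0, hN⟩, rfl⟩
  replace hp_le : ∀ n, ‖p‖ ^ 2 ≤ inner ℝ p (X n) := fun n => hp_le _ ⟨n, rfl⟩
  obtain ⟨c, hc, hc_sum, hc_comb, hc_aff⟩ :=
    exists_affineIndependent_support_of_mem_convexHull_range hp_mem
  have hp : 0 < ‖p‖ ^ 2 := by
    have hmargin := margin_mul_sum_le X hc
    rw [hc_sum, mul_one, hc_comb] at hmargin
    exact pow_pos ((margin_pos hN hX).trans_le hmargin) 2
  have hslack (n : Fin N) (hn : c n ≠ 0) : inner ℝ p (X n) = ‖p‖ ^ 2 :=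
    inner_eq_norm_sq_of_norm_sq_le_inner hc hc_sum hc_comb hp_le hn
  have hsupp : (Function.support fun n => (‖p‖ ^ 2)⁻¹ * c n) = Function.support c := by
    ext n
    simp only [Function.mem_support, ne_eq, mul_eq_zero, inv_eq_zero, hp.ne', false_or]
  refine ⟨(‖p‖ ^ 2)⁻¹ • p, fun n => (‖p‖ ^ 2)⁻¹ * c n, fun n => ?_,
    ⟨fun n => mul_nonneg (inv_nonneg.2 hp.le) (hc n), fun n hn => ?_, ?_⟩, ?_⟩
  · rw [real_inner_smul_left, ← inv_mul_cancel₀ hp.ne']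
    exact mul_le_mul_of_nonneg_left (hp_le n) (inv_nonneg.2 hp.le)
  · by_contra hcn
    refine hn ?_
    change inner ℝ ((‖p‖ ^ 2)⁻¹ • p) (X n) = 1
    rw [real_inner_smul_left, hslack n (right_ne_zero_of_mul hcn), inv_mul_cancel₀ hp.ne']
  · simp only [mul_smul, ← Finset.smul_sum, hc_comb]
  · rw [hsupp]
    exact linearIndependent_of_affineIndependent_of_inner_eq hc_aff hp.ne' fun n => hslack n n.2

theorem IsSVMDual.inner_eq_one (h : IsSVMDual X what α) {n : Fin N} (hn : α n ≠ 0) :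
    inner ℝ what (X n) = 1 :=
  by_contra fun h' => hn (h.2.1 n h')

theorem IsSVMDual.mem_span_support (h : IsSVMDual X what α) :
    what ∈ Submodule.span ℝ (X '' Function.support α) := by
  rw [h.2.2]
  refine Submodule.sum_mem _ fun n _ => ?_
  by_cases hn : α n = 0
  · simp [hn]
  · exact Submodule.smul_mem _ _ (Submodule.subset_span ⟨n, hn, rfl⟩)

theorem IsSVMDual.eq_gramSolve {A : Finset (Fin N)} (h : IsSVMDual X what α)
    (hA : ∀ n, n ∈ A ↔ α n ≠ 0) (hli : LinearIndepOn ℝ X (Function.support α)) :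
    what = gramSolve (fun i : A => X i) 1 := by
  have hAα : (A : Set (Fin N)) = Function.support α := Set.ext hA
  rw [← hAα] at hli
  refine sub_eq_zero.1 (eq_zero_of_mem_span_of_inner_eq_zero (s := X '' A)
    (Submodule.sub_mem _ ?_ ?_) ?_)
  · exact hAα ▸ h.mem_span_support
  · rw [Set.image_eq_range]
    exact gramSolve_mem_span _ _
  · rintro _ ⟨n, hn, rfl⟩
    have hone := inner_gramSolve hli 1 ⟨n, hn⟩
    rw [inner_sub_left, h.inner_eq_one ((hA n).1 hn), sub_eq_zero]
    exact hone.symm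

theorem IsGeneric.support_eq_supportIdx (hgen : IsGeneric X) (h : IsSVMDual X what α)
    (hli : LinearIndepOn ℝ X (Function.support α)) :
    Function.support α = supportIdx X what := by
  refine Set.Subset.antisymm (fun n hn => h.inner_eq_one hn) fun n hn => ?_
  by_contra hαn
  let A : Finset (Fin N) := {n | α n ≠ 0}
  have hA (n : Fin N) : n ∈ A ↔ α n ≠ 0 := by simp [A]
  refine hgen A n (fun hnA => hαn ((hA n).1 hnA)) ?_
  rw [← h.eq_gramSolve hA hli]
  exact hn

theorem ae_exists_pos_dual (hN : 0 < N) : ∀ᵐ X : Dataset N d, LinearlySeparable X →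
    ∃ (what : EuclideanSpace ℝ (Fin d)) (α : Fin N → ℝ), (∀ n, 1 ≤ inner ℝ what (X n)) ∧
      IsSVMDual X what α ∧ (∀ n ∈ supportIdx X what, 0 < α n) ∧
      LinearIndepOn ℝ X (supportIdx X what) := by
  filter_upwards [ae_isGeneric] with X hgen hX
  obtain ⟨what, α, hone, hα, hli⟩ := exists_isSVMDual_linearIndepOn hN hX
  have hsupp := hgen.support_eq_supportIdx hα hli
  refine ⟨what, α, hone, hα, fun n hn => (hα.1 n).lt_of_ne' ?_, hsupp ▸ hli⟩
  rwa [← hsupp] at hn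

theorem IsSVMDual.norm_sq_le_inner (h : IsSVMDual X what α) {w : EuclideanSpace ℝ (Fin d)}
    (hw : ∀ n, 1 ≤ inner ℝ w (X n)) : ‖what‖ ^ 2 ≤ inner ℝ w what := by
  have hexp (w : EuclideanSpace ℝ (Fin d)) : inner ℝ w what = ∑ n, α n * inner ℝ w (X n) := by
    conv_lhs => rw [h.2.2]
    simp only [inner_sum, inner_smul_right]
  rw [← real_inner_self_eq_norm_sq, hexp, hexp]
  refine Finset.sum_le_sum fun n _ => ?_
  by_cases hn : α n = 0
  · simp [hn]
  · rw [h.inner_eq_one hn]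
    exact mul_le_mul_of_nonneg_left (hw n) (h.1 n)

theorem IsSVMDual.norm_sub_sq_le (h : IsSVMDual X what α) {w : EuclideanSpace ℝ (Fin d)}
    (hw : ∀ n, 1 ≤ inner ℝ w (X n)) : ‖w - what‖ ^ 2 ≤ ‖w‖ ^ 2 - ‖what‖ ^ 2 := by
  have := h.norm_sq_le_inner hw
  rw [norm_sub_sq_real]
  linarith

theorem IsSVMDual.isMaxMarginSeparator (h : IsSVMDual X what α)
    (hone : ∀ n, 1 ≤ inner ℝ what (X n)) : IsMaxMarginSeparator X what :=
  ⟨hone, fun _ hw => sub_nonneg.1 ((sq_nonneg _).trans (h.norm_sub_sq_le hw))⟩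

theorem IsSVMDual.eq_of_isMaxMarginSeparator (h : IsSVMDual X what α)
    (hone : ∀ n, 1 ≤ inner ℝ what (X n)) {v : EuclideanSpace ℝ (Fin d)}
    (hv : IsMaxMarginSeparator X v) : v = what := by
  have hsq : ‖v - what‖ ^ 2 = 0 :=
    le_antisymm ((h.norm_sub_sq_le hv.1).trans (sub_nonpos.2 (hv.2 what hone))) (sq_nonneg _)
  exact sub_eq_zero.1 (norm_eq_zero.1 (pow_eq_zero_iff two_ne_zero |>.1 hsq))

theorem IsSVMDual.unique (h : IsSVMDual X what α) {a : Fin N → ℝ} (ha : IsSVMDual X what a)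
    (hli : LinearIndepOn ℝ X (supportIdx X what)) : a = α := by
  classical
  have hsum : ∑ n with n ∈ supportIdx X what, (a n - α n) • X n = 0 := by
    rw [Finset.sum_filter_of_ne]
    · simp only [sub_smul, Finset.sum_sub_distrib]
      rw [← ha.2.2, ← h.2.2, sub_self]
    · intro n _ hne
      by_contra hn
      rw [ha.2.1 n hn, h.2.1 n hn, sub_self, zero_smul] at hne
      exact hne rfl
  ext n
  by_cases hn : n ∈ supportIdx X what
  · exact sub_eq_zero.1 (linearIndepOn_iff'.1 hli _ _ (by simp) hsum n (by simpa using hn))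
  · rw [ha.2.1 n hn, h.2.1 n hn]

theorem exists_isResidualLimit (hpos : ∀ n ∈ supportIdx X what, 0 < α n)
    (hli : LinearIndepOn ℝ X (supportIdx X what)) (w0 : EuclideanSpace ℝ (Fin d)) :
    ∃ wtilde, IsResidualLimit X what α w0 wtilde := by
  classical
  let u := gramSolve (fun n : supportIdx X what => X n)
    fun n => -Real.log (α n) - inner ℝ w0 (X n)
  refine ⟨w0 + u, isResidualLimit_iff.2 ⟨fun n hn => ?_, ?_⟩⟩
  · have hu : inner ℝ u (X n) = -Real.log (α n) - inner ℝ w0 (X n) :=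
      inner_gramSolve hli _ ⟨n, hn⟩
    rw [real_inner_comm, inner_add_left, hu, add_sub_cancel, neg_neg, Real.exp_log (hpos n hn)]
  · rw [add_sub_cancel_left, supportSpan, Set.image_eq_range]
    exact gramSolve_mem_span _ _

theorem IsResidualLimit.unique {w0 v v' : EuclideanSpace ℝ (Fin d)}
    (hv : IsResidualLimit X what α w0 v) (hv' : IsResidualLimit X what α w0 v') : v = v' := by
  rw [isResidualLimit_iff] at hv hv'
  have hmem : v - v' ∈ supportSpan X what := by
    simpa using sub_mem hv.2 hv'.2
  refine sub_eq_zero.1 (eq_zero_of_mem_span_of_inner_eq_zero hmem ?_)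
  rintro _ ⟨n, hn, rfl⟩
  have hexp := (hv.1 n hn).trans (hv'.1 n hn).symm
  rw [Real.exp_eq_exp, neg_inj] at hexp
  rw [real_inner_comm, inner_sub_right, hexp, sub_self]

theorem SupportVectorsSpan.mem_supportSpan (h : SupportVectorsSpan X what) (n : Fin N) :
    X n ∈ supportSpan X what := by
  have hspan : supportSpan X what = Submodule.span ℝ (Set.range X) :=
    Submodule.eq_of_le_of_finrank_eq (Submodule.span_mono (Set.image_subset_range _ _)) h
  exact hspan ▸ Submodule.subset_span ⟨n, rfl⟩

end Duality

section BatchExcess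

/-- The deviation of the indicator of `n ∈ S` from its average `|S| / N` over all samples `n`. -/
noncomputable def batchExcess (S : Finset (Fin N)) (n : Fin N) : ℝ :=
  (if n ∈ S then 1 else 0) - (S.card : ℝ) / N

theorem sum_batchExcess_smul {E : Type*} [AddCommGroup E] [Module ℝ E] (S : Finset (Fin N))
    (x : Fin N → E) :
    ∑ n, batchExcess S n • x n = ∑ n ∈ S, x n - ((S.card : ℝ) / N) • ∑ n, x n := by
  simp [batchExcess, sub_smul, ite_smul, Finset.sum_sub_distrib, Finset.smul_sum]

theorem sum_batchExcess (S : Finset (Fin N)) : ∑ n, batchExcess S n = 0 := by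
  rcases N.eq_zero_or_pos with rfl | hN
  · simp
  · have h := sum_batchExcess_smul S fun _ => (1 : ℝ)
    simpa [div_mul_cancel₀, hN.ne'] using h

theorem batchExcess_sq_le_one (S : Finset (Fin N)) (n : Fin N) : batchExcess S n ^ 2 ≤ 1 := by
  have hle : (S.card : ℝ) / N ≤ 1 :=
    div_le_one_of_le₀ (by exact_mod_cast card_finset_fin_le S) (by positivity)
  have hnonneg : (0 : ℝ) ≤ (S.card : ℝ) / N := by positivity
  rw [sq_le_one_iff_abs_le_one, abs_le, batchExcess]
  split_ifs <;> constructor <;> linarith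

/-- The accumulated deviation of the weights `Z s` that the sample `n` receives in the first `t`
minibatches of `b` from their averages over a uniform choice of the samples. -/
noncomputable def samplingNoise (n : Fin N) (Z : ℕ → (ℕ → Finset (Fin N)) → ℝ) (t : ℕ)
    (b : ℕ → Finset (Fin N)) : ℝ :=
  ∑ s ∈ Finset.range t, batchExcess (b s) n * Z s b

variable {g : (ℕ → Finset (Fin N)) → ℝ} {Z : ℕ → (ℕ → Finset (Fin N)) → ℝ} {t : ℕ}

theorem dependsOn_batchExcess_mul (n : Fin N) (hg : DependsOn g (Set.Iio t)) :
    DependsOn (fun b => batchExcess (b t) n * g b) (Set.Iio (t + 1)) := fun b b' h => by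
  dsimp only
  rw [h t t.lt_succ_self, hg fun s hs => h s (Nat.lt_succ_of_lt hs)]

theorem dependsOn_samplingNoise (n : Fin N) (hZ : ∀ s, DependsOn (Z s) (Set.Iio s)) (t : ℕ) :
    DependsOn (samplingNoise n Z t) (Set.Iio t) := fun b b' h => by
  refine Finset.sum_congr rfl fun s hs => ?_
  have hst := Finset.mem_range.1 hs
  rw [h s hst, hZ s fun i hi => h i (lt_trans hi hst)]

end BatchExcess

section Sampling

variable {Ω : Type*} [mΩ : MeasurableSpace Ω] {μ : Measure Ω} {B t : ℕ}
  {batch : ℕ → Ω → Finset (Fin N)} {g : (ℕ → Finset (Fin N)) → ℝ}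
  {Z : ℕ → (ℕ → Finset (Fin N)) → ℝ}

namespace SamplingWithReplacement

/-- The information on the minibatches drawn before each iteration. -/
def filtration (hs : SamplingWithReplacement μ B batch) : Filtration ℕ mΩ where
  seq t := ⨆ s ∈ Set.Iio t, MeasurableSpace.comap (batch s) ⊤
  mono' _ _ hst := biSup_mono fun _ hi => lt_of_lt_of_le hi hst
  le' _ := iSup₂_le fun s _ => (hs.measurable s).comap_le

theorem comap_batch_le (hs : SamplingWithReplacement μ B batch) {s : ℕ} (hst : s < t) :
    MeasurableSpace.comap (batch s) ⊤ ≤ hs.filtration t :=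
  le_iSup₂_of_le (f := fun s (_ : s ∈ Set.Iio t) => MeasurableSpace.comap (batch s) ⊤) s hst le_rfl

theorem indep_filtration (hs : SamplingWithReplacement μ B batch) (t : ℕ) :
    Indep (MeasurableSpace.comap (batch t) ⊤) (hs.filtration t) μ := by
  have hindep := indep_iSup_of_disjoint (fun s => (hs.measurable s).comap_le)
    (show iIndep (fun s => MeasurableSpace.comap (batch s) ⊤) μ from hs.indep)
    (S := {t}) (T := Set.Iio t) (by simp)
  rwa [iSup_singleton] at hindep

-- The past takes only finitely many values, so that functions of it need no regularity.
theorem stronglyMeasurable_of_dependsOn (hs : SamplingWithReplacement μ B batch)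
    (hg : DependsOn g (Set.Iio t)) :
    StronglyMeasurable[hs.filtration t] fun ω => g fun s => batch s ω := by
  let : MeasurableSpace (Finset (Fin N)) := ⊤
  have : DiscreteMeasurableSpace (Finset (Fin N)) := ⟨fun _ => trivial⟩
  obtain ⟨f, rfl⟩ := dependsOn_iff_exists_comp.1 hg
  have hpast : Measurable[hs.filtration t] fun ω (s : Set.Iio t) => batch s ω :=
    @measurable_pi_lambda _ _ _ (hs.filtration t) _ _ fun s =>
      measurable_iff_comap_le.2 (hs.comap_batch_le s.2)
  exact ((measurable_of_finite f).comp hpast).stronglyMeasurable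

theorem integrable_of_dependsOn [IsFiniteMeasure μ] (hs : SamplingWithReplacement μ B batch)
    (hg : DependsOn g (Set.Iio t)) : Integrable (fun ω => g fun s => batch s ω) μ := by
  let : MeasurableSpace (Finset (Fin N)) := ⊤
  have : DiscreteMeasurableSpace (Finset (Fin N)) := ⟨fun _ => trivial⟩
  obtain ⟨f, rfl⟩ := dependsOn_iff_exists_comp.1 hg
  exact Integrable.comp_measurable (f := fun ω (s : Set.Iio t) => batch s ω) (g := f)
    .of_finite (measurable_pi_lambda _ fun s => hs.measurable s)

theorem integrable_batchExcess [IsFiniteMeasure μ] (hs : SamplingWithReplacement μ B batch)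
    (t : ℕ) (n : Fin N) : Integrable (fun ω => batchExcess (batch t ω) n) μ :=
  hs.integrable_of_dependsOn (t := t + 1) (g := fun b => batchExcess (b t) n) fun b b' h => by
    dsimp only
    rw [h t t.lt_succ_self]

variable [IsProbabilityMeasure μ]

theorem integral_batchExcess_eq_measureReal_sub (hs : SamplingWithReplacement μ B batch) (t : ℕ)
    (n : Fin N) :
    ∫ ω, batchExcess (batch t ω) n ∂μ = μ.real {ω | n ∈ batch t ω} - (B : ℝ) / N := by
  have hmeas : MeasurableSet {ω | n ∈ batch t ω} :=
    hs.measurable t (MeasurableSpace.measurableSet_top (s := {S : Finset (Fin N) | n ∈ S}))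
  have heq : ∀ ω, batchExcess (batch t ω) n =
      {ω | n ∈ batch t ω}.indicator 1 ω - (B : ℝ) / N := fun ω => by
    simp [batchExcess, hs.card_eq, Set.indicator_apply]
  simp only [heq]
  rw [integral_sub ((integrable_const 1).indicator hmeas) (integrable_const _),
    integral_indicator_one hmeas, integral_const, probReal_univ, one_smul]

theorem integral_batchExcess (hs : SamplingWithReplacement μ B batch) (t : ℕ) (n : Fin N) :
    ∫ ω, batchExcess (batch t ω) n ∂μ = 0 := by
  have hconst : ∀ m, ∫ ω, batchExcess (batch t ω) m ∂μ = ∫ ω, batchExcess (batch t ω) n ∂μ :=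
    fun m => by
      simp only [hs.integral_batchExcess_eq_measureReal_sub, Measure.real, hs.uniform t m n]
  have hsum : ∑ m, ∫ ω, batchExcess (batch t ω) m ∂μ = 0 := by
    rw [← integral_finsetSum _ fun m _ => hs.integrable_batchExcess t m]
    simp only [sum_batchExcess, integral_zero]
  simpa [hconst, n.pos.ne'] using hsum

theorem condExp_batchExcess_mul (hs : SamplingWithReplacement μ B batch)
    (hg : DependsOn g (Set.Iio t)) (n : Fin N) :
    μ[fun ω => batchExcess (batch t ω) n * g fun s => batch s ω | hs.filtration t] =ᵐ[μ] 0 := by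
  have hpull := condExp_mul_of_stronglyMeasurable_right (hs.stronglyMeasurable_of_dependsOn hg)
    (hs.integrable_of_dependsOn (dependsOn_batchExcess_mul n hg)) (hs.integrable_batchExcess t n)
  have hmeas : StronglyMeasurable[MeasurableSpace.comap (batch t) ⊤]
      fun ω => batchExcess (batch t ω) n :=
    ((measurable_from_top (f := fun S : Finset (Fin N) => batchExcess S n)).comp
      (comap_measurable _)).stronglyMeasurable
  filter_upwards [hpull, condExp_indep_eq (hs.measurable t).comap_le (hs.filtration.le t) hmeas
    (hs.indep_filtration t)] with ω hω hmean
  refine hω.trans ?_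
  rw [Pi.mul_apply, hmean, hs.integral_batchExcess, zero_mul, Pi.zero_apply]

theorem integral_sum_batch (hs : SamplingWithReplacement μ B batch)
    {φ : Fin N → (ℕ → Finset (Fin N)) → ℝ} (hφ : ∀ n, DependsOn (φ n) (Set.Iio t)) :
    ∫ ω, ∑ n ∈ batch t ω, φ n (fun s => batch s ω) ∂μ =
      (B : ℝ) / N * ∫ ω, ∑ n, φ n (fun s => batch s ω) ∂μ := by
  have hint : ∀ n, Integrable
      (fun ω => batchExcess (batch t ω) n * φ n fun s => batch s ω) μ := fun n =>
    hs.integrable_of_dependsOn (dependsOn_batchExcess_mul n (hφ n))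
  have hzero : ∀ n, ∫ ω, batchExcess (batch t ω) n * φ n (fun s => batch s ω) ∂μ = 0 := fun n => by
    rw [← integral_condExp (hs.filtration.le t),
      integral_congr_ae (hs.condExp_batchExcess_mul (hφ n) n)]
    exact integral_zero _ _
  have hsplit : ∀ ω, ∑ n ∈ batch t ω, φ n (fun s => batch s ω) =
      ∑ n, batchExcess (batch t ω) n * φ n (fun s => batch s ω) +
        (B : ℝ) / N * ∑ n, φ n (fun s => batch s ω) := fun ω => by
    have h := sum_batchExcess_smul (batch t ω) fun n => φ n fun s => batch s ω
    simp only [smul_eq_mul, hs.card_eq] at h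
    rw [h, sub_add_cancel]
  simp only [hsplit]
  rw [integral_add (integrable_finsetSum _ fun n _ => hint n)
    ((integrable_finsetSum _ fun n _ => hs.integrable_of_dependsOn (hφ n)).const_mul _),
    integral_finsetSum _ fun n _ => hint n, integral_const_mul]
  simp only [hzero, Finset.sum_const_zero, zero_add]

theorem martingale_samplingNoise (hs : SamplingWithReplacement μ B batch)
    (hZ : ∀ s, DependsOn (Z s) (Set.Iio s)) (n : Fin N) :
    Martingale (fun t ω => samplingNoise n Z t fun s => batch s ω) hs.filtration μ := by
  refine martingale_of_condExp_sub_eq_zero_nat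
    (fun t => hs.stronglyMeasurable_of_dependsOn (dependsOn_samplingNoise n hZ t))
    (fun t => hs.integrable_of_dependsOn (dependsOn_samplingNoise n hZ t)) fun t => ?_
  convert hs.condExp_batchExcess_mul (hZ t) n using 2
  ext ω
  simp [samplingNoise, Finset.sum_range_succ]

theorem ae_exists_tendsto_samplingNoise (hs : SamplingWithReplacement μ B batch)
    (hZ : ∀ s, DependsOn (Z s) (Set.Iio s))
    (hsum : Summable fun t => ∫ ω, Z t (fun s => batch s ω) ^ 2 ∂μ) (n : Fin N) :
    ∀ᵐ ω ∂μ, ∃ m, Tendsto (fun t => samplingNoise n Z t fun s => batch s ω) atTop (𝓝 m) := by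
  have hnoise := dependsOn_samplingNoise n hZ
  have hsq {t : ℕ} {g : (ℕ → Finset (Fin N)) → ℝ} (hg : DependsOn g (Set.Iio t)) :
      Integrable (fun ω => g (fun s => batch s ω) ^ 2) μ :=
    hs.integrable_of_dependsOn (g := fun b => g b ^ 2) fun b b' h => by dsimp only; rw [hg h]
  refine ae_exists_tendsto_of_summable_integral_increment_sq (hs.martingale_samplingNoise hZ n)
    (fun t => (memLp_two_iff_integrable_sq
      (hs.integrable_of_dependsOn (hnoise t)).aestronglyMeasurable).2 (hsq (hnoise t)))
    (hsum.of_nonneg_of_le (fun t => integral_nonneg fun ω => sq_nonneg _) fun t => ?_)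
  refine integral_mono_of_nonneg (.of_forall fun ω => sq_nonneg _) (hsq (hZ t))
    (.of_forall fun ω => ?_)
  simp only [samplingNoise, Finset.sum_range_succ, add_sub_cancel_left, mul_pow]
  exact mul_le_of_le_one_left (sq_nonneg _) (batchExcess_sq_le_one _ n)

end SamplingWithReplacement

end Sampling

section SampleDecrease

variable {X : Dataset N d} {ℓ : ℝ → ℝ} {β : ℝ≥0} {h : ℝ}

/-- A lower bound for the contribution of the sample `x_n` to the decrease of the loss in a
minibatch step of size `h` from `w`. -/
noncomputable def sampleDecrease (X : Dataset N d) (ℓ : ℝ → ℝ) (β : ℝ≥0) (h : ℝ)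
    (w : EuclideanSpace ℝ (Fin d)) (n : Fin N) : ℝ :=
  h * (gradCoeff X ℓ w n * inner ℝ (negGrad X ℓ w) (X n)) -
    β * sigmaMax X ^ 4 / 2 * h ^ 2 * gradCoeff X ℓ w n ^ 2

theorem empLoss_add_sum_mem_le (hℓ : Differentiable ℝ ℓ) (hβ : LipschitzWith β (deriv ℓ)) (h : ℝ)
    (w : EuclideanSpace ℝ (Fin d)) (S : Finset (Fin N)) :
    empLoss X ℓ (w + h • ∑ n ∈ S, gradCoeff X ℓ w n • X n) ≤
      empLoss X ℓ w - ∑ n ∈ S, sampleDecrease X ℓ β h w n := by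
  set s := ∑ n ∈ S, gradCoeff X ℓ w n • X n with hs
  calc empLoss X ℓ (w + h • s)
    _ ≤ empLoss X ℓ w - inner ℝ (negGrad X ℓ w) (h • s) +
          β * sigmaMax X ^ 2 / 2 * ‖h • s‖ ^ 2 := empLoss_add_le hℓ hβ X w _
    _ = empLoss X ℓ w - h * inner ℝ (negGrad X ℓ w) s +
          β * sigmaMax X ^ 2 / 2 * (h ^ 2 * ‖s‖ ^ 2) := by
        rw [inner_smul_right, norm_smul, mul_pow, Real.norm_eq_abs, sq_abs]
    _ ≤ empLoss X ℓ w - h * inner ℝ (negGrad X ℓ w) s + β * sigmaMax X ^ 2 / 2 *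
          (h ^ 2 * (sigmaMax X ^ 2 * ∑ n ∈ S, gradCoeff X ℓ w n ^ 2)) := by
        gcongr
        exact norm_sum_mem_smul_sq_le X _ S
    _ = empLoss X ℓ w - ∑ n ∈ S, sampleDecrease X ℓ β h w n := by
        simp only [sampleDecrease, Finset.sum_sub_distrib, ← Finset.mul_sum, hs, inner_sum,
          inner_smul_right]
        ring

theorem mul_sum_gradCoeff_sq_le_sum_sampleDecrease (hℓ : IsSmoothMonotoneLoss ℓ β)
    (hγ : 0 ≤ margin X) (hh : 0 ≤ h) (w : EuclideanSpace ℝ (Fin d)) :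
    (h * margin X ^ 2 - β * sigmaMax X ^ 4 / 2 * h ^ 2) * ∑ n, gradCoeff X ℓ w n ^ 2 ≤
      ∑ n, sampleDecrease X ℓ β h w n := by
  have hmargin := mul_le_mul_of_nonneg_left (margin_sq_mul_sum_gradCoeff_sq_le hℓ hγ w) hh
  simp only [sampleDecrease, Finset.sum_sub_distrib, ← Finset.mul_sum, sum_gradCoeff_mul_inner,
    real_inner_self_eq_norm_sq]
  linarith

theorem StepSizeWith.descent_rate_pos {η : ℝ} {B : ℕ} (hstep : StepSizeWith X β η B)
    (hγ : 0 < margin X) (hβ : 0 < β) (hh : 0 < η / B) :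
    0 < η / B * margin X ^ 2 - β * sigmaMax X ^ 4 / 2 * (η / B) ^ 2 := by
  have hσ : 0 < sigmaMax X := hγ.trans_le (margin_le_sigmaMax X)
  have hlt := (lt_div_iff₀ (by positivity)).1 hstep
  have hfactor : η / B * margin X ^ 2 - β * sigmaMax X ^ 4 / 2 * (η / B) ^ 2 =
      η / B * ((2 * margin X ^ 2 - η / B * (β * sigmaMax X ^ 2 * sigmaMax X ^ 2)) / 2) := by ring
  rw [hfactor]
  exact mul_pos hh (half_pos (sub_pos.2 hlt))

end SampleDecrease

section WithReplacement

variable {X : Dataset N d} {what w0 wtilde : EuclideanSpace ℝ (Fin d)} {α : Fin N → ℝ}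
  {ℓ : ℝ → ℝ} {β : ℝ≥0} {η : ℝ} {B K : ℕ}

theorem dependsOn_comp_sgd {γ : Type*} (φ : EuclideanSpace ℝ (Fin d) → γ) (t : ℕ) :
    DependsOn (fun b => φ (sgd X ℓ η B b w0 t)) (Set.Iio t) := by
  suffices h : DependsOn (fun b => sgd X ℓ η B b w0 t) (Set.Iio t) from
    fun b b' hb => congrArg φ (h hb)
  induction t with
  | zero => exact fun b b' _ => rfl
  | succ t ih =>
    intro b b' hb
    have ih' := ih fun s hs => hb s (Nat.lt_succ_of_lt hs)
    simp only [sgd_succ, hb t t.lt_succ_self, ih']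

/-- The effect on the run of the sampling noise that is still to come at iteration `t`, when the
noise accumulates to `m n` for each sample `x_n`. -/
noncomputable def remainingNoise (X : Dataset N d) (ℓ : ℝ → ℝ) (η : ℝ) (B : ℕ)
    (w0 : EuclideanSpace ℝ (Fin d)) (b : ℕ → Finset (Fin N)) (m : Fin N → ℝ) (t : ℕ) :
    EuclideanSpace ℝ (Fin d) :=
  (η / B) • ∑ n,
    (m n - samplingNoise n (fun s b => gradCoeff X ℓ (sgd X ℓ η B b w0 s) n) t b) • X n

variable {b : ℕ → Finset (Fin N)} {m : Fin N → ℝ}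

theorem tendsto_remainingNoise (hm : ∀ n, Tendsto (fun t => samplingNoise n
      (fun s b => gradCoeff X ℓ (sgd X ℓ η B b w0 s) n) t b) atTop (𝓝 (m n))) :
    Tendsto (remainingNoise X ℓ η B w0 b m) atTop (𝓝 0) := by
  have hlim := (tendsto_finsetSum Finset.univ fun n _ =>
    ((hm n).const_sub (m n)).smul_const (X n)).const_smul (η / B)
  simp only [sub_self, zero_smul, Finset.sum_const_zero, smul_zero] at hlim
  exact hlim

theorem sgd_add_remainingNoise_succ (hb : ∀ t, (b t).card = B) (t : ℕ) :
    sgd X ℓ η B b w0 (t + 1) + remainingNoise X ℓ η B w0 b m (t + 1) =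
      sgd X ℓ η B b w0 t + remainingNoise X ℓ η B w0 b m t +
        (η / B * (B / N)) • ∑ n, gradCoeff X ℓ (sgd X ℓ η B b w0 t) n • X n := by
  have hnoise := sum_batchExcess_smul (b t) fun n => gradCoeff X ℓ (sgd X ℓ η B b w0 t) n • X n
  have hsucc : remainingNoise X ℓ η B w0 b m (t + 1) = remainingNoise X ℓ η B w0 b m t -
      (η / B) • ∑ n, batchExcess (b t) n • gradCoeff X ℓ (sgd X ℓ η B b w0 t) n • X n := by
    rw [remainingNoise, remainingNoise, ← smul_sub, ← Finset.sum_sub_distrib]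
    simp only [samplingNoise, Finset.sum_range_succ, smul_smul, ← sub_smul, sub_sub]
  rw [hsucc, hnoise, sgd_succ, hb, mul_smul, smul_sub]
  abel

theorem isExpDriven_sgd_add_remainingNoise (hℓ : IsSmoothMonotoneLoss ℓ β)
    (htail : Tendsto (fun u => -deriv ℓ u * Real.exp u) atTop (𝓝 1))
    (hb : ∀ t, (b t).card = B)
    (hsum : ∀ n, Summable fun t => gradCoeff X ℓ (sgd X ℓ η B b w0 t) n ^ 2)
    (hm : ∀ n, Tendsto (fun t => samplingNoise n
      (fun s b => gradCoeff X ℓ (sgd X ℓ η B b w0 s) n) t b) atTop (𝓝 (m n))) :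
    IsExpDriven X (η / B * (B / N)) (fun t => gradCoeff X ℓ (sgd X ℓ η B b w0 t))
      fun t => sgd X ℓ η B b w0 t + remainingNoise X ℓ η B w0 b m t where
  step := sgd_add_remainingNoise_succ hb
  nonneg t n := (gradCoeff_pos hℓ X _ n).le
  tail n := tendsto_gradCoeff_mul_exp hℓ htail (hsum n) <| by
    simpa only [sub_add_cancel_left, neg_zero] using (tendsto_remainingNoise hm).neg
  summable_sq := hsum

theorem IsRegularLimit.add_left_of_mem (H : IsRegularLimit X what α w0 wtilde)
    {e : EuclideanSpace ℝ (Fin d)} (he : e ∈ supportSpan X what) :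
    IsRegularLimit X what α (w0 + e) wtilde where
  one_le := H.one_le
  dual := H.dual
  mem_span := H.mem_span
  residual := by
    obtain ⟨hexp, hmem⟩ := isResidualLimit_iff.1 H.residual
    exact isResidualLimit_iff.2 ⟨hexp, by rw [← sub_sub]; exact sub_mem hmem he⟩

theorem hasLogAsymptotics_of_tendsto_samplingNoise (H : IsRegularLimit X what α w0 wtilde)
    (hℓ : IsSmoothMonotoneLoss ℓ β)
    (htail : Tendsto (fun u => -deriv ℓ u * Real.exp u) atTop (𝓝 1))
    (hBK : B * K = N) (hh : 0 < η / B) (hN : 0 < N) (hb : ∀ t, (b t).card = B)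
    (hsum : ∀ n, Summable fun t => gradCoeff X ℓ (sgd X ℓ η B b w0 t) n ^ 2)
    (hm : ∀ n, Tendsto (fun t => samplingNoise n
      (fun s b => gradCoeff X ℓ (sgd X ℓ η B b w0 s) n) t b) atTop (𝓝 (m n))) :
    HasLogAsymptotics (sgd X ℓ η B b w0) what wtilde η B K := by
  subst hBK
  have hB : 0 < B := Nat.pos_of_mul_pos_right hN
  have hstart := H.add_left_of_mem (Submodule.smul_mem _ (η / B) (H.sum_smul_mem fun n =>
    m n - samplingNoise n (fun s b => gradCoeff X ℓ (sgd X ℓ η B b w0 s) n) 0 b))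
  have hlim := ((isExpDriven_sgd_add_remainingNoise hℓ htail hb hsum hm).tendsto_sub_log
    (by positivity) hstart).sub (tendsto_remainingNoise hm)
  rw [sub_zero] at hlim
  refine hlim.congr fun t => ?_
  have htime : η / B * (B / (B * K : ℕ)) * t = η / B * (t / K) := by
    push_cast
    field_simp
  rw [htime]
  abel

variable {Ω : Type*} [MeasurableSpace Ω] {μ : Measure Ω} [IsProbabilityMeasure μ]
  {batch : ℕ → Ω → Finset (Fin N)}

theorem SamplingWithReplacement.integral_empLoss_sgd_succ_le
    (hs : SamplingWithReplacement μ B batch) (hℓ : IsSmoothMonotoneLoss ℓ β)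
    (hγ : 0 ≤ margin X) (hh : 0 ≤ η / B) (t : ℕ) :
    ∫ ω, empLoss X ℓ (sgd X ℓ η B (fun s => batch s ω) w0 (t + 1)) ∂μ ≤
      ∫ ω, empLoss X ℓ (sgd X ℓ η B (fun s => batch s ω) w0 t) ∂μ -
        B / N * (η / B * margin X ^ 2 - β * sigmaMax X ^ 4 / 2 * (η / B) ^ 2) *
          ∫ ω, ∑ n, gradCoeff X ℓ (sgd X ℓ η B (fun s => batch s ω) w0 t) n ^ 2 ∂μ := by
  have hint (φ : EuclideanSpace ℝ (Fin d) → ℝ) (t : ℕ) :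
      Integrable (fun ω => φ (sgd X ℓ η B (fun s => batch s ω) w0 t)) μ :=
    hs.integrable_of_dependsOn (dependsOn_comp_sgd φ t)
  set c := η / B * margin X ^ 2 - β * sigmaMax X ^ 4 / 2 * (η / B) ^ 2
  set w := fun t ω => sgd X ℓ η B (fun s => batch s ω) w0 t
  have hbatch : Integrable
      (fun ω => ∑ n ∈ batch t ω, sampleDecrease X ℓ β (η / B) (w t ω) n) μ :=
    hs.integrable_of_dependsOn (t := t + 1)
      (g := fun b => ∑ n ∈ b t, sampleDecrease X ℓ β (η / B) (sgd X ℓ η B b w0 t) n)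
      fun b b' hb => by
        have hw : sgd X ℓ η B b w0 t = sgd X ℓ η B b' w0 t :=
          dependsOn_comp_sgd id t fun s hs => hb s (Nat.lt_succ_of_lt hs)
        simp only [hw, hb t t.lt_succ_self]
  calc ∫ ω, empLoss X ℓ (w (t + 1) ω) ∂μ
    _ ≤ ∫ ω, (empLoss X ℓ (w t ω) -
          ∑ n ∈ batch t ω, sampleDecrease X ℓ β (η / B) (w t ω) n) ∂μ :=
        integral_mono (hint _ _) ((hint _ _).sub hbatch) fun ω => by
          simpa only [w, sgd_succ] using
            empLoss_add_sum_mem_le hℓ.differentiable hℓ.smooth (η / B) (w t ω) (batch t ω)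
    _ = ∫ ω, empLoss X ℓ (w t ω) ∂μ -
          B / N * ∫ ω, ∑ n, sampleDecrease X ℓ β (η / B) (w t ω) n ∂μ := by
        rw [integral_sub (hint _ _) hbatch, hs.integral_sum_batch fun n =>
          dependsOn_comp_sgd (fun v => sampleDecrease X ℓ β (η / B) v n) t]
    _ ≤ ∫ ω, empLoss X ℓ (w t ω) ∂μ -
          B / N * ∫ ω, c * ∑ n, gradCoeff X ℓ (w t ω) n ^ 2 ∂μ := by
        gcongr _ - _ * ?_
        exact integral_mono (hint (fun v => c * ∑ n, gradCoeff X ℓ v n ^ 2) t)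
          (hint (fun v => ∑ n, sampleDecrease X ℓ β (η / B) v n) t)
          fun ω => mul_sum_gradCoeff_sq_le_sum_sampleDecrease hℓ hγ hh (w t ω)
    _ = ∫ ω, empLoss X ℓ (w t ω) ∂μ -
          B / N * c * ∫ ω, ∑ n, gradCoeff X ℓ (w t ω) n ^ 2 ∂μ := by
        rw [integral_const_mul, mul_assoc]

theorem SamplingWithReplacement.summable_integral_gradCoeff_sq
    (hs : SamplingWithReplacement μ B batch) (hℓ : IsSmoothMonotoneLoss ℓ β)
    (hγ : 0 < margin X) (hB : 0 < B) (hη : 0 < η) (hstep : StepSizeWith X β η B) (n : Fin N) :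
    Summable fun t => ∫ ω, gradCoeff X ℓ (sgd X ℓ η B (fun s => batch s ω) w0 t) n ^ 2 ∂μ := by
  have hN := n.pos
  have hh : 0 < η / B := by positivity
  have hrate := hstep.descent_rate_pos hγ hℓ.smoothness_pos hh
  have hBN : 0 < (B : ℝ) / N := by positivity
  have hsum : Summable fun t =>
      ∫ ω, ∑ n, gradCoeff X ℓ (sgd X ℓ η B (fun s => batch s ω) w0 t) n ^ 2 ∂μ :=
    summable_of_descent
      (L := fun t => ∫ ω, empLoss X ℓ (sgd X ℓ η B (fun s => batch s ω) w0 t) ∂μ)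
      (mul_pos hBN hrate)
      (fun t => integral_nonneg fun ω => empLoss_nonneg hℓ X _)
      (fun t => integral_nonneg fun ω => Finset.sum_nonneg fun n _ => sq_nonneg _)
      fun t => hs.integral_empLoss_sgd_succ_le hℓ hγ.le hh.le t
  refine hsum.of_nonneg_of_le (fun t => integral_nonneg fun ω => sq_nonneg _) fun t => ?_
  refine integral_mono_of_nonneg (.of_forall fun ω => sq_nonneg _)
    (hs.integrable_of_dependsOn (dependsOn_comp_sgd (fun v => ∑ n, gradCoeff X ℓ v n ^ 2) t))
    (.of_forall fun ω => ?_)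
  exact Finset.single_le_sum
    (f := fun n => gradCoeff X ℓ (sgd X ℓ η B (fun s => batch s ω) w0 t) n ^ 2)
    (fun n _ => sq_nonneg _) (Finset.mem_univ n)

theorem ae_hasLogAsymptotics_of_caseWith (hN : 0 < N) (H : IsRegularLimit X what α w0 wtilde)
    (hℓ : IsSmoothMonotoneLoss ℓ β)
    (htail : Tendsto (fun u => -deriv ℓ u * Real.exp u) atTop (𝓝 1))
    (hcase : CaseWith μ X β η B K batch) :
    ∀ᵐ ω ∂μ, HasLogAsymptotics (sgd X ℓ η B (fun t => batch t ω) w0) what wtilde η B K := by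
  obtain ⟨hη, hBK, hstep, hs⟩ := hcase
  have hB : 0 < B := Nat.pos_of_mul_pos_right (hBK ▸ hN)
  have hsum := hs.summable_integral_gradCoeff_sq (w0 := w0) hℓ (H.margin_pos hN) hB hη hstep
  have hdep (n : Fin N) := dependsOn_comp_sgd (X := X) (ℓ := ℓ) (η := η) (B := B) (w0 := w0)
    fun v => gradCoeff X ℓ v n
  have hsq : ∀ᵐ ω ∂μ, ∀ n, Summable fun t =>
      gradCoeff X ℓ (sgd X ℓ η B (fun s => batch s ω) w0 t) n ^ 2 :=
    ae_all_iff.2 fun n => ae_summable_of_summable_integral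
      (fun t => hs.integrable_of_dependsOn (dependsOn_comp_sgd (fun v => gradCoeff X ℓ v n ^ 2) t))
      (fun t ω => sq_nonneg _) (hsum n)
  have hnoise : ∀ᵐ ω ∂μ, ∀ n, ∃ m, Tendsto (fun t => samplingNoise n
      (fun s b => gradCoeff X ℓ (sgd X ℓ η B b w0 s) n) t fun s => batch s ω) atTop (𝓝 m) :=
    ae_all_iff.2 fun n => hs.ae_exists_tendsto_samplingNoise (hdep n) (hsum n) n
  filter_upwards [hsq, hnoise] with ω hω hm
  choose m hm using hm
  exact hasLogAsymptotics_of_tendsto_samplingNoise H hℓ htail hBK (by positivity) hN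
    (hs.card_eq · ω) hω hm

end WithReplacement

section Epochs

theorem AgreePerEpoch.of_hasLogAsymptotics {w₁ w₂ : ℕ → EuclideanSpace ℝ (Fin d)}
    {what wtilde : EuclideanSpace ℝ (Fin d)} {η₁ η₂ : ℝ} {B₁ B₂ K₁ K₂ : ℕ}
    (h₁ : HasLogAsymptotics w₁ what wtilde η₁ B₁ K₁)
    (h₂ : HasLogAsymptotics w₂ what wtilde η₂ B₂ K₂)
    (hK₁ : 0 < K₁) (hK₂ : 0 < K₂) (hh : η₁ / B₁ ≠ 0) (heq : η₁ / B₁ = η₂ / B₂) :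
    AgreePerEpoch w₁ w₂ K₁ K₂ := by
  have hfloor {K : ℕ} (hK : 0 < K) : Tendsto (fun τ : ℝ => ⌊K * τ⌋₊) atTop atTop :=
    tendsto_nat_floor_atTop.comp (tendsto_id.const_mul_atTop (Nat.cast_pos.2 hK))
  have hlog := ((tendsto_log_mul_floor_div_sub hh (Nat.cast_pos.2 hK₁)).sub
    (tendsto_log_mul_floor_div_sub hh (Nat.cast_pos.2 hK₂))).smul_const what
  have hlim := ((h₁.comp (hfloor hK₁)).sub (h₂.comp (hfloor hK₂))).add hlog
  simp only [sub_zero, zero_smul, add_zero] at hlim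
  refine hlim.congr fun τ => ?_
  simp only [Function.comp_apply, ← heq, sub_smul]
  abel

variable {X : Dataset N d} {what w0 wtilde : EuclideanSpace ℝ (Fin d)} {α : Fin N → ℝ}
  {ℓ : ℝ → ℝ} {β : ℝ≥0} {η η₁ η₂ : ℝ} {B B₁ B₂ K K₁ K₂ : ℕ}

theorem stepSize_pos_and_epochLength_pos (hN : 0 < N) (hη : 0 < η) (hBK : B * K = N) :
    0 < η / B ∧ 0 < K := by
  subst hBK
  exact ⟨div_pos hη (Nat.cast_pos.2 (Nat.pos_of_mul_pos_right hN)), Nat.pos_of_mul_pos_left hN⟩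

theorem agreePerEpoch_of_caseWithout (hN : 0 < N) (H : IsRegularLimit X what α w0 wtilde)
    (hℓ : IsSmoothMonotoneLoss ℓ β)
    (htail : Tendsto (fun u => -deriv ℓ u * Real.exp u) atTop (𝓝 1))
    {batch₁ batch₂ : ℕ → Finset (Fin N)} (h₁ : CaseWithout X β η₁ B₁ K₁ batch₁)
    (h₂ : CaseWithout X β η₂ B₂ K₂ batch₂) (heq : η₁ / B₁ = η₂ / B₂) :
    AgreePerEpoch (sgd X ℓ η₁ B₁ batch₁ w0) (sgd X ℓ η₂ B₂ batch₂ w0) K₁ K₂ := by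
  obtain ⟨hh, hK₁⟩ := stepSize_pos_and_epochLength_pos hN h₁.1 h₁.2.1
  obtain ⟨-, hK₂⟩ := stepSize_pos_and_epochLength_pos hN h₂.1 h₂.2.1
  exact .of_hasLogAsymptotics (hasLogAsymptotics_of_caseWithout hN H hℓ htail h₁)
    (hasLogAsymptotics_of_caseWithout hN H hℓ htail h₂) hK₁ hK₂ hh.ne' heq

variable {Ω : Type*} [MeasurableSpace Ω] {μ : Measure Ω} [IsProbabilityMeasure μ]
  {batch batch₁ batch₂ : ℕ → Ω → Finset (Fin N)}

theorem pos_and_mul_eq_of_case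
    (h : CaseWith μ X β η B K batch ∨ ∀ ω, CaseWithout X β η B K fun t => batch t ω) :
    0 < η ∧ B * K = N := by
  obtain ⟨ω⟩ := nonempty_of_isProbabilityMeasure μ
  exact h.elim (fun h => ⟨h.1, h.2.1⟩) fun h => ⟨(h ω).1, (h ω).2.1⟩

theorem ae_hasLogAsymptotics_of_case (hN : 0 < N) (H : IsRegularLimit X what α w0 wtilde)
    (hℓ : IsSmoothMonotoneLoss ℓ β)
    (htail : Tendsto (fun u => -deriv ℓ u * Real.exp u) atTop (𝓝 1))
    (h : CaseWith μ X β η B K batch ∨ ∀ ω, CaseWithout X β η B K fun t => batch t ω) :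
    ∀ᵐ ω ∂μ, HasLogAsymptotics (sgd X ℓ η B (fun t => batch t ω) w0) what wtilde η B K :=
  h.elim (ae_hasLogAsymptotics_of_caseWith hN H hℓ htail) fun h =>
    .of_forall fun ω => hasLogAsymptotics_of_caseWithout hN H hℓ htail (h ω)

theorem ae_agreePerEpoch_of_case (hN : 0 < N) (H : IsRegularLimit X what α w0 wtilde)
    (hℓ : IsSmoothMonotoneLoss ℓ β)
    (htail : Tendsto (fun u => -deriv ℓ u * Real.exp u) atTop (𝓝 1))
    (h₁ : CaseWith μ X β η₁ B₁ K₁ batch₁ ∨ ∀ ω, CaseWithout X β η₁ B₁ K₁ fun t => batch₁ t ω)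
    (h₂ : CaseWith μ X β η₂ B₂ K₂ batch₂ ∨ ∀ ω, CaseWithout X β η₂ B₂ K₂ fun t => batch₂ t ω)
    (heq : η₁ / B₁ = η₂ / B₂) :
    ∀ᵐ ω ∂μ, AgreePerEpoch (sgd X ℓ η₁ B₁ (fun t => batch₁ t ω) w0)
      (sgd X ℓ η₂ B₂ (fun t => batch₂ t ω) w0) K₁ K₂ := by
  obtain ⟨hη₁, hBK₁⟩ := pos_and_mul_eq_of_case h₁
  obtain ⟨hη₂, hBK₂⟩ := pos_and_mul_eq_of_case h₂
  obtain ⟨hh, hK₁⟩ := stepSize_pos_and_epochLength_pos hN hη₁ hBK₁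
  obtain ⟨-, hK₂⟩ := stepSize_pos_and_epochLength_pos hN hη₂ hBK₂
  filter_upwards [ae_hasLogAsymptotics_of_case hN H hℓ htail h₁,
    ae_hasLogAsymptotics_of_case hN H hℓ htail h₂] with ω hω₁ hω₂
  exact .of_hasLogAsymptotics hω₁ hω₂ hK₁ hK₂ hh.ne' heq

end Epochs

end MinibatchSGD

open MinibatchSGD in
theorem corollary1_general {N d : ℕ} (hN : 0 < N) :
    ∀ᵐ X : Dataset N d, LinearlySeparable X →
      ∃ (what : EuclideanSpace ℝ (Fin d)) (α : Fin N → ℝ),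
        (IsMaxMarginSeparator X what ∧ ∀ v, IsMaxMarginSeparator X v → v = what) ∧
        (IsSVMDual X what α ∧ ∀ a, IsSVMDual X what a → a = α) ∧
        (SupportVectorsSpan X what → ∀ w0 : EuclideanSpace ℝ (Fin d),
          ∃ wtilde : EuclideanSpace ℝ (Fin d),
            (IsResidualLimit X what α w0 wtilde ∧
              ∀ v, IsResidualLimit X what α w0 v → v = wtilde) ∧
            ∀ (ℓ : ℝ → ℝ) (β : ℝ≥0), IsSmoothMonotoneLoss ℓ β →
              Tendsto (fun u => -deriv ℓ u * Real.exp u) atTop (𝓝 1) →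
              (∀ (Ω : Type*) [MeasurableSpace Ω] (μ : Measure Ω) [IsProbabilityMeasure μ]
                (η : ℝ) (B K : ℕ) (batch : ℕ → Ω → Finset (Fin N)),
                CaseWith μ X β η B K batch →
                ∀ᵐ ω ∂μ, HasLogAsymptotics (sgd X ℓ η B (fun t => batch t ω) w0)
                  what wtilde η B K) ∧
              (∀ (η : ℝ) (B K : ℕ) (batch : ℕ → Finset (Fin N)),
                CaseWithout X β η B K batch →
                HasLogAsymptotics (sgd X ℓ η B batch w0) what wtilde η B K) ∧
              (∀ (Ω : Type*) [MeasurableSpace Ω] (μ : Measure Ω) [IsProbabilityMeasure μ]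
                (η₁ η₂ : ℝ) (B₁ B₂ K₁ K₂ : ℕ) (batch₁ batch₂ : ℕ → Ω → Finset (Fin N)),
                (CaseWith μ X β η₁ B₁ K₁ batch₁ ∨
                  ∀ ω, CaseWithout X β η₁ B₁ K₁ (fun t => batch₁ t ω)) →
                (CaseWith μ X β η₂ B₂ K₂ batch₂ ∨
                  ∀ ω, CaseWithout X β η₂ B₂ K₂ (fun t => batch₂ t ω)) →
                η₁ / B₁ = η₂ / B₂ →
                ∀ᵐ ω ∂μ, AgreePerEpoch (sgd X ℓ η₁ B₁ (fun t => batch₁ t ω) w0)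
                  (sgd X ℓ η₂ B₂ (fun t => batch₂ t ω) w0) K₁ K₂) ∧
              (∀ (η₁ η₂ : ℝ) (B₁ B₂ K₁ K₂ : ℕ) (batch₁ batch₂ : ℕ → Finset (Fin N)),
                CaseWithout X β η₁ B₁ K₁ batch₁ → CaseWithout X β η₂ B₂ K₂ batch₂ →
                η₁ / B₁ = η₂ / B₂ →
                AgreePerEpoch (sgd X ℓ η₁ B₁ batch₁ w0) (sgd X ℓ η₂ B₂ batch₂ w0) K₁ K₂)) := by
  filter_upwards [ae_exists_pos_dual (d := d) hN] with X hX hsep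
  obtain ⟨what, α, hone, hdual, hpos, hli⟩ := hX hsep
  refine ⟨what, α,
    ⟨hdual.isMaxMarginSeparator hone, fun v hv => hdual.eq_of_isMaxMarginSeparator hone hv⟩,
    ⟨hdual, fun a ha => hdual.unique ha hli⟩, fun hspan w0 => ?_⟩
  obtain ⟨wtilde, hres⟩ := exists_isResidualLimit hpos hli w0
  have H : IsRegularLimit X what α w0 wtilde := ⟨hone, hdual, hspan.mem_supportSpan, hres⟩
  refine ⟨wtilde, ⟨hres, fun v hv => hv.unique hres⟩, fun ℓ β hℓ htail => ⟨?_, ?_, ?_, ?_⟩⟩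
  · intro Ω _ μ _ η B K batch hcase
    exact ae_hasLogAsymptotics_of_caseWith hN H hℓ htail hcase
  · intro η B K batch hcase
    exact hasLogAsymptotics_of_caseWithout hN H hℓ htail hcase
  · intro Ω _ μ _ η₁ η₂ B₁ B₂ K₁ K₂ batch₁ batch₂ h₁ h₂ heq
    exact ae_agreePerEpoch_of_case hN H hℓ htail h₁ h₂ heq
  · intro η₁ η₂ B₁ B₂ K₁ K₂ batch₁ batch₂ h₁ h₂ heq
    exact agreePerEpoch_of_caseWithout hN H hℓ htail h₁ h₂ heq

open MinibatchSGD in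
theorem corollary1 {N d : ℕ} (hN : 0 < N) :
    ∀ᵐ X : Dataset N d, LinearlySeparable X →
      ∃ (what : EuclideanSpace ℝ (Fin d)) (α : Fin N → ℝ),
        (IsMaxMarginSeparator X what ∧ ∀ v, IsMaxMarginSeparator X v → v = what) ∧
        (IsSVMDual X what α ∧ ∀ a, IsSVMDual X what a → a = α) ∧
        (SupportVectorsSpan X what → ∀ w0 : EuclideanSpace ℝ (Fin d),
          ∃ wtilde : EuclideanSpace ℝ (Fin d),
            (IsResidualLimit X what α w0 wtilde ∧
              ∀ v, IsResidualLimit X what α w0 v → v = wtilde) ∧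
            ∀ (ℓ : ℝ → ℝ) (β : ℝ≥0), IsSmoothMonotoneLoss ℓ β →
              HasTightExpTail (fun u => -deriv ℓ u) →
              -- random sampling with replacement: almost surely
              (∀ (Ω : Type*) [MeasurableSpace Ω] (μ : Measure Ω) [IsProbabilityMeasure μ]
                (η : ℝ) (B K : ℕ) (batch : ℕ → Ω → Finset (Fin N)),
                CaseWith μ X β η B K batch →
                ∀ᵐ ω ∂μ, HasLogAsymptotics (sgd X ℓ η B (fun t => batch t ω) w0)
                  what wtilde η B K) ∧
              -- sampling without replacement: surely
              (∀ (η : ℝ) (B K : ℕ) (batch : ℕ → Finset (Fin N)),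
                CaseWithout X β η B K batch →
                HasLogAsymptotics (sgd X ℓ η B batch w0) what wtilde η B K) ∧
              -- proportional step sizes: the number of minibatches only rescales time;
              -- almost surely, for runs in either sampling regime
              (∀ (Ω : Type*) [MeasurableSpace Ω] (μ : Measure Ω) [IsProbabilityMeasure μ]
                (η₁ η₂ : ℝ) (B₁ B₂ K₁ K₂ : ℕ) (batch₁ batch₂ : ℕ → Ω → Finset (Fin N)),
                (CaseWith μ X β η₁ B₁ K₁ batch₁ ∨
                  ∀ ω, CaseWithout X β η₁ B₁ K₁ (fun t => batch₁ t ω)) →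
                (CaseWith μ X β η₂ B₂ K₂ batch₂ ∨
                  ∀ ω, CaseWithout X β η₂ B₂ K₂ (fun t => batch₂ t ω)) →
                η₁ / B₁ = η₂ / B₂ →
                ∀ᵐ ω ∂μ, AgreePerEpoch (sgd X ℓ η₁ B₁ (fun t => batch₁ t ω) w0)
                  (sgd X ℓ η₂ B₂ (fun t => batch₂ t ω) w0) K₁ K₂) ∧
              -- surely, for two runs without replacement
              (∀ (η₁ η₂ : ℝ) (B₁ B₂ K₁ K₂ : ℕ) (batch₁ batch₂ : ℕ → Finset (Fin N)),
                CaseWithout X β η₁ B₁ K₁ batch₁ → CaseWithout X β η₂ B₂ K₂ batch₂ →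
                η₁ / B₁ = η₂ / B₂ →
                AgreePerEpoch (sgd X ℓ η₁ B₁ batch₁ w0) (sgd X ℓ η₂ B₂ batch₂ w0) K₁ K₂)) := by
  filter_upwards [corollary1_general hN] with X h hX
  obtain ⟨what, α, hsep, hdual, hlim⟩ := h hX
  exact ⟨what, α, hsep, hdual, fun hspan w0 => (hlim hspan w0).imp fun _ h =>
    h.imp_right fun h ℓ β hℓ htail => h ℓ β hℓ htail.tendsto_mul_exp⟩
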